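/- **Setting.** Fix an integer $N\ge 3$. Put $q=\frac1N\cdot\frac{2}{1+\sqrt{1-4/N^2}}\in(0,1)$, $[n]_q=q^{1-n}\,\frac{1-q^{2n}}{1-q^2}$ and $$C(q)=(1-q^2)^{-1/2}\Big(\prod_{s\ge1}\frac1{1-q^{2s}}\Big)^{3/2}.$$ Let $H_1=\mathbb C^N$ with standard orthonormal basis $e_1,\dots,e_N$, and let $T_1=\sum_{i=1}^N e_i\otimes e_i$. The Jones–Wenzl projections $p_n$ on $H_1^{\otimes n}$ are given by $p_0=1$, $p_1=\iota$ and, for $n\ge2$, $$p_n=\iota\otimes p_{n-1}-\frac{[n-1]_q}{[n]_q}(\iota\otimes p_{n-1})(T_1T_1^*\otimes\iota_{H_1^{\otimes n-2}})(\iota\otimes p_{n-1}).$$ Put $H_n=p_n(H_1^{\otimes n})$; this is the space of the $n$-th irreducible representation of the free orthogonal quantum group $O_N^+$. A triple $(k,l,m)\in\mathbb N_0^3$ is *admissible* if $k=l+m-2r$ for an integer $0\le r\le\min\{l,m\}$. For such a triple let $$A_k^{l,m}=(p_l\otimes p_m)(\iota_{H_1^{\otimes l-r}}\otimes T_r\otimes\iota_{H_1^{\otimes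 m-r}})|_{H_k}:H_k\to H_l\otimes H_m,$$ $$T_r=\sum_{i:\{1,\dots,r\}\to\{1,\dots,N\}}e_{i(1)}\otimes\cdots\otimes e_{i(r)}\otimes e_{i(r)}\otimes\cdots\otimes e_{i(1)},\qquad \alpha_k^{l,m}=\|A_k^{l,m}\|^{-1}A_k^{l,m}.$$ A non-zero vector of $H_A\otimes H_B$ is *separable* if it has the form $\eta\otimes\zeta$. A subspace is *separable* if it contains a separable vector and *entangled* if it contains none. The *Schmidt coefficients* of a unit vector $\xi$ are the numbers $\lambda_i\ge0$ in a singular value decomposition $\xi=\sum_i\sqrt{\lambda_i}\,e_i\otimes f_i$ with $(e_i)$, $(f_i)$ orthonormal. A subspace is *highly entangled* if the Schmidt coefficients of its unit vectors are bounded by a constant less than $1$. **Theorem.** For every $n$, $p_n$ is a non-zero self-adjoint projection in $\mathrm{Hom}(u^{\otimes n},u^{\otimes n})$, where $u$ is the fundamental representation of $O_N^+$, and $(\iota_{H_1^{\otimes i-1}}\otimes T_1T_1^*\otimes\iota_{H_1^{\otimes n-i-1}})p_n=0$ for $1\le i\le n-1$. Let $(k,l,m)$ be an admissible triple. Then $\alpha_k^{l,m}$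 is an isometry, and the following hold. 1. If $k<l+m$, the subspace $\alpha_k^{l,m}(H_k)\subseteq H_l\otimes H_m$ is entangled and highly entangled: every Schmidt coefficient of every unit vector in it is at most $C(q)^2q^{(l+m-k)/2}$, and $C(q)^2q^{(l+m-k)/2}<1$. 2. If $k=l+m$, the subspace $\alpha_{l+m}^{l,m}(H_{l+m})\subseteq H_l\otimes H_m$ is separable. More precisely, for $i\neq j$ write $\eta_n(i,j)=e_i\otimes e_j\otimes e_i\otimes\cdots\in H_1^{\otimes n}$ ($n$ alternating factors), and put $\eta'=\eta_m(i,j)$ if $l$ is even and $\eta'=\eta_m(j,i)$ if $l$ is odd. Then $\eta_l(i,j)\in H_l$, $\eta'\in H_m$, and $\eta_l(i,j)\otimes\eta'\in\alpha_{l+m}^{l,m}(H_{l+m})$. -/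

import Mathlib

open scoped TensorProduct

noncomputable section

namespace FreeOrth

/-! ### Entanglement in a tensor product of two Hilbert spaces -/

section Entanglement

variable {E F : Type*} [NormedAddCommGroup E] [InnerProductSpace ℂ E]
  [NormedAddCommGroup F] [InnerProductSpace ℂ F]

/-- A non-zero vector of `E ⊗ F` is separable if it is a product vector `η ⊗ ζ`. -/
def IsSeparableVector (ξ : E ⊗[ℂ] F) : Prop :=
  ξ ≠ 0 ∧ ∃ (η : E) (ζ : F), ξ = η ⊗ₜ[ℂ] ζ

/-- A subspace is separable if it contains a separable vector. -/
def IsSeparableSubspace (K : Submodule ℂ (E ⊗[ℂ] F)) : Prop :=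
  ∃ ξ ∈ K, IsSeparableVector ξ

/-- A subspace is entangled if it contains no separable vector. -/
def IsEntangledSubspace (K : Submodule ℂ (E ⊗[ℂ] F)) : Prop :=
  ∀ ξ ∈ K, ¬ IsSeparableVector ξ

/-- `ξ = ∑ i, √(lam i) e i ⊗ f i` is a singular value decomposition of `ξ`: the systems `e` and `f`
are orthonormal and the Schmidt coefficients `lam i` are non-negative. The number `n` of terms and
their order are left free, so that coefficients equal to zero may be listed or not. -/
structure IsSchmidtDecomposition {n : ℕ} (ξ : E ⊗[ℂ] F) (lam : Fin n → ℝ)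
    (e : Fin n → E) (f : Fin n → F) : Prop where
  nonneg : ∀ i, 0 ≤ lam i
  orthonormal_left : Orthonormal ℂ e
  orthonormal_right : Orthonormal ℂ f
  eq_sum : ξ = ∑ i, ((Real.sqrt (lam i) : ℝ) : ℂ) • (e i ⊗ₜ[ℂ] f i)

/-- All the Schmidt coefficients of all the unit vectors of `K` are at most `c`. -/
def SchmidtCoeffsLE (K : Submodule ℂ (E ⊗[ℂ] F)) (c : ℝ) : Prop :=
  ∀ ξ ∈ K, ‖ξ‖ = 1 → ∀ (n : ℕ) (lam : Fin n → ℝ) (e : Fin n → E) (f : Fin n → F),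
    IsSchmidtDecomposition ξ lam e f → ∀ i, lam i ≤ c

/-- A subspace is highly entangled if the Schmidt coefficients of its unit vectors are bounded away
from one. -/
def IsHighlyEntangled (K : Submodule ℂ (E ⊗[ℂ] F)) : Prop :=
  ∃ c < 1, SchmidtCoeffsLE K c

end Entanglement

/-! ### The quantum parameter -/

/-- `q(N) = (1 / N) * (2 / (1 + √(1 - 4 / N²)))`. -/
def qParam (N : ℕ) : ℝ :=
  1 / (N : ℝ) * (2 / (1 + Real.sqrt (1 - 4 / (N : ℝ) ^ 2)))

/-- The quantum integer `[n]_q = q^(1-n) (1 - q^(2n)) / (1 - q²)`. -/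
def qInt (q : ℝ) (n : ℕ) : ℝ :=
  q ^ (1 - (n : ℤ)) * ((1 - q ^ (2 * n)) / (1 - q ^ 2))

/-- `C(q) = (1 - q²)^(-1/2) (∏_{s ≥ 1} 1 / (1 - q^(2s)))^(3/2)`. -/
def constC (q : ℝ) : ℝ :=
  (1 - q ^ 2) ^ (-(1 / 2) : ℝ) * (∏' s : ℕ, 1 / (1 - q ^ (2 * (s + 1)))) ^ (3 / 2 : ℝ)

/-! ### The free orthogonal quantum group and its intertwiners -/

/-- The relations `∑ₖ X i k X j k = δ i j = ∑ₖ X k i X k j`. -/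
inductive OrthRel (N : ℕ) :
    FreeAlgebra ℂ (Fin N × Fin N) → FreeAlgebra ℂ (Fin N × Fin N) → Prop
  | row (i j : Fin N) : OrthRel N
      (∑ k, FreeAlgebra.ι ℂ (i, k) * FreeAlgebra.ι ℂ (j, k)) (if i = j then 1 else 0)
  | col (i j : Fin N) : OrthRel N
      (∑ k, FreeAlgebra.ι ℂ (k, i) * FreeAlgebra.ι ℂ (k, j)) (if i = j then 1 else 0)

/-- The algebra `𝒪(O_N⁺)`. The generators are self-adjoint, so as an algebra it is generated by the
entries of an orthogonal matrix; intertwiners do not refer to the involution. -/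
abbrev OrthAlg (N : ℕ) : Type := RingQuot (OrthRel N)

/-- The generators `u i j`, i.e. the fundamental representation of `O_N⁺`. -/
def fundRep (N : ℕ) : Matrix (Fin N) (Fin N) (OrthAlg N) :=
  Matrix.of fun i j => RingQuot.mkAlgHom ℂ (OrthRel N) (FreeAlgebra.ι ℂ (i, j))

/-- The representation `u^{⊗ n}`, with entries `u (x 0) (y 0) ⋯ u (x (n-1)) (y (n-1))`. -/
def tensorRep (N n : ℕ) : Matrix (Fin n → Fin N) (Fin n → Fin N) (OrthAlg N) :=
  Matrix.of fun x y => (List.ofFn fun s => fundRep N (x s) (y s)).prod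

/-- `T ∈ Hom(U, V)`, i.e. `T U = V T` for matrices `U`, `V` over an algebra and `T` over `ℂ`. -/
def IsIntertwiner {A ι κ : Type*} [Ring A] [Algebra ℂ A] [Fintype ι] [Fintype κ]
    (U : Matrix ι ι A) (V : Matrix κ κ A) (T : Matrix κ ι ℂ) : Prop :=
  T.map (algebraMap ℂ A) * U = V * T.map (algebraMap ℂ A)

/-! ### Jones-Wenzl projections

`H_1^{⊗ n}` is the Hilbert space with orthonormal basis `e x = e_{x 0} ⊗ ⋯ ⊗ e_{x (n-1)}`, for
`x : Fin n → Fin N`, and operators on it are matrices with respect to that basis. -/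

/-- `H_1^{⊗ n}` where `H_1 = ℂ^N`. -/
abbrev TPow (N n : ℕ) : Type := EuclideanSpace ℂ (Fin n → Fin N)

/-- The basis vector `e x = e_{x 0} ⊗ ⋯ ⊗ e_{x (n-1)}`. -/
def basisVec (N n : ℕ) (x : Fin n → Fin N) : TPow N n := EuclideanSpace.single x 1

/-- `ι_{H_1} ⊗ S`. -/
def idTensor {N n : ℕ} (S : Matrix (Fin n → Fin N) (Fin n → Fin N) ℂ) :
    Matrix (Fin (n + 1) → Fin N) (Fin (n + 1) → Fin N) ℂ :=
  Matrix.of fun x y => if x 0 = y 0 then S (Fin.tail x) (Fin.tail y) else 0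

/-- `ι ⊗ T₁ T₁* ⊗ ι` on `H_1^{⊗ n}`, acting on the two neighbouring legs `a` and `a + 1` (counted
from `0`), where `T₁ = ∑ i, e i ⊗ e i`. -/
def cupCap (N n a : ℕ) (ha : a + 1 < n) : Matrix (Fin n → Fin N) (Fin n → Fin N) ℂ :=
  Matrix.of fun x y =>
    if x ⟨a, by omega⟩ = x ⟨a + 1, ha⟩ ∧ y ⟨a, by omega⟩ = y ⟨a + 1, ha⟩ ∧
        ∀ s : Fin n, s.val ≠ a → s.val ≠ a + 1 → x s = y s
    then 1 else 0

/-- The Jones-Wenzl projection `p_n` on `H_1^{⊗ n}`, given by the Wenzl recursion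
`p_n = ι ⊗ p_{n-1} - ([n-1]/[n]) (ι ⊗ p_{n-1}) (T₁ T₁* ⊗ ι) (ι ⊗ p_{n-1})`. -/
def jonesWenzl (N : ℕ) : (n : ℕ) → Matrix (Fin n → Fin N) (Fin n → Fin N) ℂ
  | 0 => 1
  | 1 => 1
  | n + 2 =>
    idTensor (jonesWenzl N (n + 1)) -
      ((qInt (qParam N) (n + 1) / qInt (qParam N) (n + 2) : ℝ) : ℂ) •
        (idTensor (jonesWenzl N (n + 1)) * cupCap N (n + 2) 0 (by omega) *
          idTensor (jonesWenzl N (n + 1)))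

/-- `p` is a non-zero self-adjoint projection in `Hom(u^{⊗ n}, u^{⊗ n})` that is annihilated by every
`ι ⊗ T₁ T₁* ⊗ ι`. -/
structure IsJonesWenzl (N n : ℕ) (p : Matrix (Fin n → Fin N) (Fin n → Fin N) ℂ) : Prop where
  intertwiner : IsIntertwiner (tensorRep N n) (tensorRep N n) p
  ne_zero : p ≠ 0
  selfAdjoint : p.IsHermitian
  idempotent : p * p = p
  cupCap_mul : ∀ (a : ℕ) (ha : a + 1 < n), cupCap N n a ha * p = 0

/-- `p_n` as a linear operator on `H_1^{⊗ n}`. -/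
def jwMap (N n : ℕ) : TPow N n →ₗ[ℂ] TPow N n := Matrix.toEuclideanLin (jonesWenzl N n)

/-- The irreducible representation space `H_n = p_n (H_1^{⊗ n})`, as a subspace. -/
def hwSubspace (N n : ℕ) : Submodule ℂ (TPow N n) := LinearMap.range (jwMap N n)

/-- The Hilbert space `H_n`, with the inner product inherited from `H_1^{⊗ n}`. -/
def HW (N n : ℕ) : Type := hwSubspace N n

instance (N n : ℕ) : NormedAddCommGroup (HW N n) :=
  inferInstanceAs (NormedAddCommGroup (hwSubspace N n))

instance (N n : ℕ) : InnerProductSpace ℂ (HW N n) :=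
  inferInstanceAs (InnerProductSpace ℂ (hwSubspace N n))

instance (N n : ℕ) : FiniteDimensional ℂ (HW N n) :=
  inferInstanceAs (FiniteDimensional ℂ (hwSubspace N n))

/-- The inclusion `H_n → H_1^{⊗ n}`. -/
def hwIncl (N n : ℕ) : HW N n →ₗ[ℂ] TPow N n := (hwSubspace N n).subtype

/-- `p_n` as a map `H_1^{⊗ n} → H_n`. -/
def hwProj (N n : ℕ) : TPow N n →ₗ[ℂ] HW N n := (jwMap N n).rangeRestrict

/-! ### Three-vertices and the isometries `α_k^{l,m}` -/

/-- `(k, l, m)` is admissible: `k = l + m - 2r` for some `0 ≤ r ≤ min l m`. -/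
def Admissible (k l m : ℕ) : Prop := ∃ r, r ≤ min l m ∧ k + 2 * r = l + m

/-- For `k = l + m - 2r`: the basis vector `e x ⊗ e y` occurs in the image of `e z` under
`ι_{l-r} ⊗ T_r ⊗ ι_{m-r}`. That is, `x` starts with the first `l - r` letters of `z`, `y` ends with
the last `m - r` letters of `z`, and the last `r` letters of `x` are, in reversed order, the first `r`
letters of `y`. -/
def Occurs {N : ℕ} (k l m r : ℕ) (z : Fin k → Fin N) (x : Fin l → Fin N) (y : Fin m → Fin N) :
    Prop :=
  (∀ (s : Fin l) (t : Fin k), s.val + r < l → t.val = s.val → x s = z t) ∧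
  (∀ (s : Fin m) (t : Fin k), r ≤ s.val → t.val + 2 * r = l + s.val → y s = z t) ∧
  (∀ (s : Fin l) (t : Fin m), t.val < r → s.val + t.val + 1 = l → x s = y t)

open Classical in
/-- The map `ι_{l-r} ⊗ T_r ⊗ ι_{m-r} : H_1^{⊗ k} → H_1^{⊗ l} ⊗ H_1^{⊗ m}` for `k = l + m - 2r`, where
`T_r = ∑ i, e_{i 1} ⊗ ⋯ ⊗ e_{i r} ⊗ e_{i r} ⊗ ⋯ ⊗ e_{i 1}`. -/
def insertCups (N k l m r : ℕ) : TPow N k →ₗ[ℂ] TPow N l ⊗[ℂ] TPow N m :=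
  (EuclideanSpace.basisFun (Fin k → Fin N) ℂ).toBasis.constr ℂ fun z =>
    ∑ x : Fin l → Fin N, ∑ y : Fin m → Fin N,
      if Occurs k l m r z x y then basisVec N l x ⊗ₜ[ℂ] basisVec N m y else 0

/-- The three-vertex `A_k^{l,m} = (p_l ⊗ p_m) (ι_{l-r} ⊗ T_r ⊗ ι_{m-r}) p_k : H_k → H_l ⊗ H_m`, where
`r = (l + m - k) / 2`. -/
def threeVertex (N k l m : ℕ) : HW N k →ₗ[ℂ] HW N l ⊗[ℂ] HW N m :=
  TensorProduct.map (hwProj N l) (hwProj N m) ∘ₗ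
    insertCups N k l m ((l + m - k) / 2) ∘ₗ hwIncl N k

/-- `α_k^{l,m} = ‖A_k^{l,m}‖⁻¹ A_k^{l,m}`, with the operator norm. -/
def alpha (N k l m : ℕ) : HW N k →ₗ[ℂ] HW N l ⊗[ℂ] HW N m :=
  ((‖LinearMap.toContinuousLinearMap (threeVertex N k l m)‖⁻¹ : ℝ) : ℂ) • threeVertex N k l m

/-- The alternating tensor `e i ⊗ e j ⊗ e i ⊗ ⋯` with `n` factors. -/
def altVec (N n : ℕ) (i j : Fin N) : TPow N n :=
  basisVec N n fun s => if Even s.val then i else j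

end FreeOrth

end

noncomputable section

namespace FreeOrth

open Matrix

variable {N : ℕ}

/-! ### Rectangular calculus of the first tensor leg -/

/-! Read a tensor in `H_1^{⊗l} ⊗ H_1^{⊗m}` as a matrix whose rows are the reversed left words. Inner
products become Hilbert–Schmidt products, and the nested cups `T_r` become the identity on the first
`r` legs. If `X` is the matrix of a vector of `H_{i+j}`, its image under the three-vertex is `V_r =
p_{i+r} (ι^{⊗r} ⊗ X) p_{j+r}`, and `V_{r+1}` is the compression of `ι ⊗ V_r`.

The adjoint of `ι ⊗ ·` is the partial trace over the first leg. Expanding the projections by the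
Wenzl recursion shows that the partial trace of `V_{r+1}` is `ρ_r V_r`, where `ρ_r` satisfies an
affine recursion solved by `[r+1][i+j+r+2] / ([i+r+1][j+r+1])`
(`TurnbackFree.headTrace_vertexMatrix`). Hence the three-vertex is `√(ρ_0 ⋯ ρ_{r-1})` times an
isometry (`inner_threeVertex`).

For the entanglement bound, let `η ∈ H_l` and `ζ ∈ H_m` be unit vectors. The projections act
trivially on `η ⊗ ζ`, and Cauchy–Schwarz, one cup at a time, bounds its overlap with the
unnormalised image of a unit vector by `1` (`norm_inner_tmul_insertCups_le`). After normalisation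
the squared overlap is at most `1 / (ρ_0 ⋯ ρ_{r-1})`, and `ρ_s ≥ (1 - q^(2(s+1)))² / q` turns this
into `C(q)² q^r`. A Schmidt coefficient is such a squared overlap; a unit product vector would have
coefficient one, which `C(q)² q < 1` forbids.

At the highest weight, the range of `p_n` consists of the vectors annihilated by `T_1*` on all
neighbouring legs (`TurnbackFree.jonesWenzl_mulVec`). Alternating words have no equal neighbours, so
they lie there, and cutting such a word gives a product vector. -/

theorem sum_word_succ {M : Type*} [AddCommMonoid M] {n : ℕ} (f : (Fin (n + 1) → Fin N) → M) :
    ∑ x, f x = ∑ a, ∑ x : Fin n → Fin N, f (Fin.cons a x : Fin (n + 1) → Fin N) := by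
  rw [← (Fin.consEquiv (fun _ : Fin (n + 1) => Fin N)).sum_comp, Fintype.sum_prod_type]
  rfl

theorem word_cases {n : ℕ} {P : (Fin (n + 1) → Fin N) → Prop}
    (h : ∀ a (x : Fin n → Fin N), P (Fin.cons a x : Fin (n + 1) → Fin N)) (x) : P x := by
  rw [← Fin.cons_self_tail x]; exact h _ _

/-- `ι_{H_1} ⊗ X` for `X` between different tensor powers. -/
def consId {a b : ℕ} (X : Matrix (Fin a → Fin N) (Fin b → Fin N) ℂ) :
    Matrix (Fin (a + 1) → Fin N) (Fin (b + 1) → Fin N) ℂ :=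
  Matrix.of fun x y => if x 0 = y 0 then X (Fin.tail x) (Fin.tail y) else 0

/-- The partial trace over the first leg. -/
def headTrace {a b : ℕ} (Y : Matrix (Fin (a + 1) → Fin N) (Fin (b + 1) → Fin N) ℂ) :
    Matrix (Fin a → Fin N) (Fin b → Fin N) ℂ :=
  Matrix.of fun x y => ∑ c : Fin N,
    Y (Fin.cons c x : Fin (a + 1) → Fin N) (Fin.cons c y : Fin (b + 1) → Fin N)

/-- `T₁ ⊗ ι`. -/
def cup (N n : ℕ) : Matrix (Fin (n + 2) → Fin N) (Fin n → Fin N) ℂ :=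
  Matrix.of fun x y => if x 0 = x 1 ∧ Fin.tail (Fin.tail x) = y then 1 else 0

section calculus

variable {a b c : ℕ}

@[simp] theorem consId_cons (X : Matrix (Fin a → Fin N) (Fin b → Fin N) ℂ) (s t x y) :
    consId X (Fin.cons s x : Fin (a + 1) → Fin N) (Fin.cons t y : Fin (b + 1) → Fin N) =
      if s = t then X x y else 0 := by
  simp [consId]

@[simp] theorem cup_cons (s t : Fin N) (x y : Fin a → Fin N) :
    cup N a (Fin.cons s (Fin.cons t x : Fin (a + 1) → Fin N) : Fin (a + 2) → Fin N) y =
      if s = t ∧ x = y then 1 else 0 := by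
  rfl

theorem ext_cons {X Y : Matrix (Fin (a + 1) → Fin N) (Fin (b + 1) → Fin N) ℂ}
    (h : ∀ s x t y, X (Fin.cons s x : Fin (a + 1) → Fin N) (Fin.cons t y : Fin (b + 1) → Fin N) =
      Y (Fin.cons s x : Fin (a + 1) → Fin N) (Fin.cons t y : Fin (b + 1) → Fin N)) : X = Y := by
  ext x y
  revert x y
  exact word_cases fun s x => word_cases fun t y => h s x t y

theorem consId_mul (X : Matrix (Fin a → Fin N) (Fin b → Fin N) ℂ)
    (Y : Matrix (Fin b → Fin N) (Fin c → Fin N) ℂ) :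
    consId (X * Y) = consId X * consId Y := by
  refine ext_cons fun s x t y => ?_
  simp only [Matrix.mul_apply, sum_word_succ, consId_cons]
  rw [Finset.sum_eq_single s (by intro u _ hu; simp [hu.symm]) (by simp)]
  by_cases h : s = t <;> simp [h]

theorem consId_smul (z : ℂ) (X : Matrix (Fin a → Fin N) (Fin b → Fin N) ℂ) :
    consId (z • X) = z • consId X := by
  refine ext_cons fun s x t y => ?_
  simp only [Matrix.smul_apply, consId_cons]
  split_ifs <;> simp

theorem consId_zero : consId (0 : Matrix (Fin a → Fin N) (Fin b → Fin N) ℂ) = 0 := by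
  refine ext_cons fun s x t y => ?_
  simp

theorem consId_one : consId (1 : Matrix (Fin a → Fin N) (Fin a → Fin N) ℂ) = 1 := by
  refine ext_cons fun s x t y => ?_
  simp only [consId_cons, Matrix.one_apply, Fin.cons_inj]
  split_ifs <;> simp_all

theorem consId_transpose (X : Matrix (Fin a → Fin N) (Fin b → Fin N) ℂ) :
    (consId X)ᵀ = consId Xᵀ := by
  refine ext_cons fun s x t y => ?_
  simp only [Matrix.transpose_apply, consId_cons, eq_comm]

theorem consId_conjTranspose (X : Matrix (Fin a → Fin N) (Fin b → Fin N) ℂ) :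
    (consId X)ᴴ = consId Xᴴ := by
  refine ext_cons fun s x t y => ?_
  simp only [Matrix.conjTranspose_apply, consId_cons]
  split_ifs <;> simp_all

theorem headTrace_sub (X Y : Matrix (Fin (a + 1) → Fin N) (Fin (b + 1) → Fin N) ℂ) :
    headTrace (X - Y) = headTrace X - headTrace Y := by
  ext x y; simp [headTrace]

theorem headTrace_add (X Y : Matrix (Fin (a + 1) → Fin N) (Fin (b + 1) → Fin N) ℂ) :
    headTrace (X + Y) = headTrace X + headTrace Y := by
  ext x y; simp [headTrace, Finset.sum_add_distrib]

theorem headTrace_smul (z : ℂ) (X : Matrix (Fin (a + 1) → Fin N) (Fin (b + 1) → Fin N) ℂ) :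
    headTrace (z • X) = z • headTrace X := by
  ext x y; simp [headTrace, Finset.mul_sum]

theorem headTrace_consId (X : Matrix (Fin a → Fin N) (Fin b → Fin N) ℂ) :
    headTrace (consId X) = (N : ℂ) • X := by
  ext x y; simp [headTrace]

theorem headTrace_consId_mul (X : Matrix (Fin a → Fin N) (Fin b → Fin N) ℂ)
    (Y : Matrix (Fin (b + 1) → Fin N) (Fin (c + 1) → Fin N) ℂ) :
    headTrace (consId X * Y) = X * headTrace Y := by
  ext x y
  simp only [headTrace, Matrix.of_apply, Matrix.mul_apply, sum_word_succ, consId_cons,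
    Finset.mul_sum]
  rw [Finset.sum_comm' (t' := Finset.univ) (s' := fun _ => Finset.univ) (by simp)]
  rw [Finset.sum_comm (s := (Finset.univ : Finset (Fin b → Fin N)))]
  refine Finset.sum_congr rfl fun s _ => ?_
  rw [Finset.sum_eq_single s (by intro u _ hu; simp [hu]) (by simp)]
  simp

theorem headTrace_mul_consId (Y : Matrix (Fin (a + 1) → Fin N) (Fin (b + 1) → Fin N) ℂ)
    (X : Matrix (Fin b → Fin N) (Fin c → Fin N) ℂ) :
    headTrace (Y * consId X) = headTrace Y * X := by
  have h := congrArg Matrix.transpose (headTrace_consId_mul Xᵀ Yᵀ)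
  rw [Matrix.transpose_mul, Matrix.transpose_transpose, ← consId_transpose,
    ← Matrix.transpose_mul] at h
  exact h

/-- The cup creates two new legs in front of those on which `X` acts, so the two slide past each
other. -/
theorem cup_mul (X : Matrix (Fin a → Fin N) (Fin b → Fin N) ℂ) :
    cup N a * X = consId (consId X) * cup N b := by
  ext x y
  revert x
  refine word_cases fun s => word_cases fun t x => ?_
  simp only [Matrix.mul_apply, sum_word_succ, consId_cons, cup_cons]
  rw [Finset.sum_eq_single s (by intro u _ hu; simp [hu.symm]) (by simp),
    Finset.sum_eq_single t (by intro u _ hu; simp [hu.symm]) (by simp),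
    Finset.sum_eq_single x (by intro u _ hu; simp [hu.symm]) (by simp),
    Finset.sum_eq_single y (by intro u _ hu; simp [hu]) (by simp)]
  simp

theorem mul_cup_transpose (X : Matrix (Fin a → Fin N) (Fin b → Fin N) ℂ) :
    X * (cup N b)ᵀ = (cup N a)ᵀ * consId (consId X) := by
  have h := congrArg Matrix.transpose (cup_mul Xᵀ)
  simpa [consId_transpose] using h

/-- The cup and the cap join the added strand to the first leg of `X` at both ends and close a loop,
which is a partial trace. -/
theorem cup_transpose_mul_consId_mul_cup
    (X : Matrix (Fin (a + 1) → Fin N) (Fin (b + 1) → Fin N) ℂ) :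
    (cup N a)ᵀ * consId X * cup N b = headTrace X := by
  ext x y
  simp only [Matrix.mul_apply, sum_word_succ, consId_cons, cup_cons, Matrix.transpose_apply,
    headTrace, Matrix.of_apply]
  refine Finset.sum_congr rfl fun s _ => ?_
  rw [Finset.sum_eq_single s (by intro u _ hu; simp [hu.symm]) (by simp),
    Finset.sum_eq_single y (by intro u _ hu; simp [hu]) (by simp),
    Finset.sum_eq_single s (by intro u _ hu; simp [hu]) (by simp),
    Finset.sum_eq_single s (by intro u _ hu; simp [hu.symm]) (by simp),
    Finset.sum_eq_single x (by intro u _ hu; simp [hu]) (by simp)]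
  simp

/-- Snake identity: closing the first leg straightens the cup and the cap into a single strand. -/
theorem headTrace_cup_mul_mul_cup_transpose (Z : Matrix (Fin a → Fin N) (Fin b → Fin N) ℂ) :
    headTrace (cup N a * Z * (cup N b)ᵀ) = consId Z := by
  refine ext_cons fun s x t y => ?_
  simp only [Matrix.mul_apply, cup_cons, Matrix.transpose_apply, headTrace, Matrix.of_apply,
    consId_cons]
  rw [Finset.sum_eq_single s (by intro u _ hu; simp [hu]) (by simp),
    Finset.sum_eq_single y (by intro u _ hu; simp [hu.symm]) (by simp),
    Finset.sum_eq_single x (by intro u _ hu; simp [hu.symm]) (by simp)]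
  simp

theorem headTrace_cup_mul_cup_transpose :
    headTrace (cup N a * (cup N a)ᵀ) = 1 := by
  have h := headTrace_cup_mul_mul_cup_transpose
    (1 : Matrix (Fin a → Fin N) (Fin a → Fin N) ℂ)
  rwa [Matrix.mul_one, consId_one] at h

theorem cupCap_zero (h : 0 + 1 < a + 2) : cupCap N (a + 2) 0 h = cup N a * (cup N a)ᵀ := by
  refine ext_cons fun s => word_cases fun s' x t => word_cases fun t' y => ?_
  simp only [Matrix.mul_apply, cup_cons, Matrix.transpose_apply]
  rw [Finset.sum_eq_single x (by intro u _ hu; simp [hu.symm]) (by simp)]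
  simp only [cupCap, Matrix.of_apply, Fin.forall_fin_succ]
  simp [← funext_iff, ite_and, show (⟨0, by omega⟩ : Fin (a + 2)) = 0 from rfl,
    show (⟨0 + 1, by omega⟩ : Fin (a + 2)) = Fin.succ 0 from rfl, eq_comm (a := x)]
  split_ifs <;> rfl

theorem cupCap_succ {s : ℕ} (h : s + 1 < a) (h' : s + 1 + 1 < a + 1) :
    cupCap N (a + 1) (s + 1) h' = consId (cupCap N a s h) := by
  refine ext_cons fun t x u y => ?_
  rw [consId_cons]
  simp only [cupCap, Matrix.of_apply, Fin.forall_fin_succ]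
  have e1 : (⟨s + 1, by omega⟩ : Fin (a + 1)) = Fin.succ ⟨s, by omega⟩ := rfl
  have e2 : (⟨s + 1 + 1, h'⟩ : Fin (a + 1)) = Fin.succ ⟨s + 1, h⟩ := rfl
  rw [← ite_and]
  simp only [e1, e2, Fin.cons_succ, Fin.cons_zero, Fin.val_succ, ne_eq, Nat.add_right_cancel_iff]
  refine if_congr ?_ rfl rfl
  simp
  tauto

/-- This adjunction converts the partial-trace recursion for three-vertices into one for their
norms. -/
theorem trace_consId_conjTranspose_mul (X : Matrix (Fin a → Fin N) (Fin b → Fin N) ℂ)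
    (Y : Matrix (Fin (a + 1) → Fin N) (Fin (b + 1) → Fin N) ℂ) :
    ((consId X)ᴴ * Y).trace = (Xᴴ * headTrace Y).trace := by
  rw [consId_conjTranspose, ← headTrace_consId_mul]
  simp only [Matrix.trace, Matrix.diag, sum_word_succ, headTrace, Matrix.of_apply]
  exact Finset.sum_comm

end calculus

/-! ### The quantum parameter and quantum integers -/

/-- `q` is the smaller root of `q² - N q + 1`. It is largest for `N = 3`, where it is `(3 - √5)/2 ≈
0.38197`; the decimal bound serves the final numerical estimate. -/
theorem qParam_spec (hN : 3 ≤ N) :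
    0 < qParam N ∧ qParam N ≤ 0.3821 ∧ qParam N ^ 2 + 1 = N * qParam N := by
  have hN' : (3 : ℝ) ≤ N := by exact_mod_cast hN
  have h4 : 4 / (N : ℝ) ^ 2 ≤ 4 / 9 := by
    apply div_le_div_of_nonneg_left <;> nlinarith
  set s := Real.sqrt (1 - 4 / (N : ℝ) ^ 2) with hs
  have hs0 : (0.745 : ℝ) ≤ s := by
    apply Real.le_sqrt_of_sq_le; norm_num; linarith
  have hs2 : s ^ 2 = 1 - 4 / (N : ℝ) ^ 2 := Real.sq_sqrt (by linarith)
  have hq : qParam N = 2 / (N * (1 + s)) := by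
    rw [qParam, ← hs, div_mul_div_comm, one_mul]
  have hpos : 0 < N * (1 + s) := by positivity
  refine ⟨by rw [hq]; positivity, ?_, ?_⟩
  · rw [hq, div_le_iff₀ hpos]
    nlinarith
  · have hN0 : (N : ℝ) ≠ 0 := by positivity
    have h1 : (1 + s) ≠ 0 := by positivity
    have h3 : (N : ℝ) ^ 2 * s ^ 2 = N ^ 2 - 4 := by rw [hs2]; field_simp
    rw [hq]
    field_simp
    linear_combination h3

theorem qInt_eq {q : ℝ} (hq : q ≠ 0) (n : ℕ) :
    qInt q n = q / q ^ n * ((1 - q ^ (2 * n)) / (1 - q ^ 2)) := by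
  rw [qInt, zpow_sub₀ hq, zpow_one, zpow_natCast]

theorem qInt_zero (q : ℝ) : qInt q 0 = 0 := by simp [qInt]

theorem qInt_pos {q : ℝ} (hq0 : 0 < q) (hq1 : q < 1) (n : ℕ) : 0 < qInt q (n + 1) := by
  have h1 : 0 < 1 - q ^ 2 := by nlinarith
  have h2 : q ^ (2 * (n + 1)) < 1 := pow_lt_one₀ hq0.le hq1 (by omega)
  have h3 : 0 < 1 - q ^ (2 * (n + 1)) := by linarith
  rw [qInt_eq hq0.ne']
  positivity

theorem qInt_add_two {q : ℝ} (hq0 : 0 < q) (hq1 : q < 1) (n : ℕ) :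
    q * qInt q (n + 2) = (q ^ 2 + 1) * qInt q (n + 1) - q * qInt q n := by
  have h1 : 1 - q ^ 2 ≠ 0 := by nlinarith
  simp only [qInt_eq hq0.ne']
  field_simp
  ring

/-- Mixed product identity for quantum integers. -/
theorem qInt_mul_identity {q : ℝ} (hq0 : 0 < q) (hq1 : q < 1) (i j r : ℕ) :
    q * (qInt q (r + 1) * qInt q (i + j + r + 2)) =
      (q ^ 2 + 1) * (qInt q (i + r + 1) * qInt q (j + r + 1)) -
        q * (qInt q (j + r) * qInt q (i + r + 1)) - q * (qInt q (i + r) * qInt q (j + r + 1)) +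
        q * (qInt q r * qInt q (i + j + r + 1)) := by
  have h1 : 1 - q ^ 2 ≠ 0 := by nlinarith
  simp only [qInt_eq hq0.ne']
  field_simp
  ring

/-! ### Jones-Wenzl projections -/

/-- The coefficient `[n] / [n+1]` of the Wenzl recursion. -/
def wenzlCoeff (N n : ℕ) : ℂ := ((qInt (qParam N) n / qInt (qParam N) (n + 1) : ℝ) : ℂ)

theorem wenzlCoeff_zero : wenzlCoeff N 0 = 0 := by simp [wenzlCoeff, qInt_zero]

/-- This is `[n+2] = N [n+1] - [n]` divided by `[n+2]`. It is the normalisation that makes the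
correction term of the Wenzl recursion a projection. -/
theorem natCast_sub_wenzlCoeff_mul (hN : 3 ≤ N) (n : ℕ) :
    ((N : ℂ) - wenzlCoeff N n) * wenzlCoeff N (n + 1) = 1 := by
  obtain ⟨h0, h1, h2⟩ := qParam_spec hN
  have hq1 : qParam N < 1 := by linarith [show (0.3821 : ℝ) < 1 by norm_num]
  have e : ((N : ℝ) - qInt (qParam N) n / qInt (qParam N) (n + 1)) *
      (qInt (qParam N) (n + 1) / qInt (qParam N) (n + 2)) = 1 := by
    have := qInt_add_two h0 hq1 n
    have p1 := (qInt_pos h0 hq1 n).ne'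
    have p2 := (qInt_pos h0 hq1 (n + 1)).ne'
    rw [h2] at this
    have h3 : qInt (qParam N) (n + 2) = N * qInt (qParam N) (n + 1) - qInt (qParam N) n := by
      apply mul_left_cancel₀ h0.ne'
      rw [this]; ring
    rw [show n + 1 + 1 = n + 2 from rfl] at p2
    rw [mul_div_assoc', div_eq_one_iff_eq p2, h3]
    field_simp
  simp only [wenzlCoeff]
  exact_mod_cast e

theorem jonesWenzl_add_two (n : ℕ) : jonesWenzl N (n + 2) =
    consId (jonesWenzl N (n + 1)) - wenzlCoeff N (n + 1) •
      (consId (jonesWenzl N (n + 1)) * (cup N n * (cup N n)ᵀ) * consId (jonesWenzl N (n + 1))) := by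
  rw [jonesWenzl, cupCap_zero]
  rfl

theorem headTrace_one {n : ℕ} :
    headTrace (1 : Matrix (Fin (n + 1) → Fin N) (Fin (n + 1) → Fin N) ℂ) = (N : ℂ) • 1 := by
  rw [← consId_one, headTrace_consId]

/-- Idempotency is a hypothesis here because this formula feeds the induction that proves it. -/
theorem headTrace_jonesWenzl_of_idempotent {n : ℕ}
    (h : jonesWenzl N n * jonesWenzl N n = jonesWenzl N n) :
    headTrace (jonesWenzl N (n + 1)) = ((N : ℂ) - wenzlCoeff N n) • jonesWenzl N n := by
  rcases n with _ | n
  · rw [wenzlCoeff_zero, sub_zero]; exact headTrace_one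
  · rw [jonesWenzl_add_two, headTrace_sub, headTrace_smul, headTrace_mul_consId,
      headTrace_consId_mul, headTrace_cup_mul_cup_transpose, Matrix.mul_one, h, headTrace_consId,
      sub_smul]

theorem jonesWenzl_mul_consId_of_idempotent {n : ℕ}
    (h : jonesWenzl N n * jonesWenzl N n = jonesWenzl N n) :
    jonesWenzl N (n + 1) * consId (jonesWenzl N n) = jonesWenzl N (n + 1) := by
  rcases n with _ | n
  · rw [jonesWenzl, jonesWenzl, consId_one, Matrix.mul_one]
  · rw [jonesWenzl_add_two, Matrix.sub_mul, Matrix.smul_mul, Matrix.mul_assoc (_ * _),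
      ← consId_mul, h]

/-- `p_n` slides through the cup and is absorbed by `p_{n+1}`. -/
theorem consId_jonesWenzl_mul_cup_of_idempotent {n : ℕ}
    (h : jonesWenzl N n * jonesWenzl N n = jonesWenzl N n) :
    consId (jonesWenzl N (n + 1)) * cup N n * jonesWenzl N n =
      consId (jonesWenzl N (n + 1)) * cup N n := by
  rw [Matrix.mul_assoc, cup_mul, ← Matrix.mul_assoc, ← consId_mul,
    jonesWenzl_mul_consId_of_idempotent h]

/-- Put `P = ι ⊗ p_{n+1}` and `Q = P T T* P`. Since `T* P T` is the partial trace `g p_n`, one gets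
`Q² = g Q` with `g w = 1`. So `w Q` is a projection below `P`, and `P - w Q` is again a projection.
-/
theorem jonesWenzl_idempotent (hN : 3 ≤ N) :
    ∀ n, jonesWenzl N n * jonesWenzl N n = jonesWenzl N n
  | 0 => by simp [jonesWenzl]
  | 1 => by simp [jonesWenzl]
  | n + 2 => by
    have h0 := jonesWenzl_idempotent hN n
    have h1 : consId (jonesWenzl N (n + 1)) * consId (jonesWenzl N (n + 1)) =
        consId (jonesWenzl N (n + 1)) := by rw [← consId_mul, jonesWenzl_idempotent hN (n + 1)]
    have h2 := cup_transpose_mul_consId_mul_cup (jonesWenzl N (n + 1))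
    rw [headTrace_jonesWenzl_of_idempotent h0] at h2
    have h3 := consId_jonesWenzl_mul_cup_of_idempotent h0
    have h4 := natCast_sub_wenzlCoeff_mul hN n
    rw [jonesWenzl_add_two]
    set P := consId (jonesWenzl N (n + 1))
    set g := (N : ℂ) - wenzlCoeff N n
    set w := wenzlCoeff N (n + 1)
    have h5 : (P * (cup N n * (cup N n)ᵀ) * P) * (P * (cup N n * (cup N n)ᵀ) * P) =
        g • (P * (cup N n * (cup N n)ᵀ) * P) := by
      calc _ = P * cup N n * ((cup N n)ᵀ * (P * P) * cup N n) * (cup N n)ᵀ * P := by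
            simp only [Matrix.mul_assoc]
        _ = _ := by
            rw [h1, h2, Matrix.mul_smul, h3]
            simp only [Matrix.smul_mul, Matrix.mul_assoc]
    have h6 : P * (P * (cup N n * (cup N n)ᵀ) * P) = P * (cup N n * (cup N n)ᵀ) * P := by
      rw [← Matrix.mul_assoc, ← Matrix.mul_assoc, h1]
    have h7 : (P * (cup N n * (cup N n)ᵀ) * P) * P = P * (cup N n * (cup N n)ᵀ) * P := by
      rw [Matrix.mul_assoc, h1]
    set Q := P * (cup N n * (cup N n)ᵀ) * P
    rw [Matrix.sub_mul, Matrix.mul_sub, Matrix.mul_sub, h1, Matrix.smul_mul, Matrix.mul_smul,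
      Matrix.smul_mul, Matrix.mul_smul, h5, h6, h7]
    have h8 : w • w • g • Q = w • Q := by
      rw [smul_smul, smul_smul, show w * w * g = w * (g * w) by ring, h4, mul_one]
    rw [h8, sub_self, sub_zero]

theorem headTrace_jonesWenzl (hN : 3 ≤ N) (n : ℕ) :
    headTrace (jonesWenzl N (n + 1)) = ((N : ℂ) - wenzlCoeff N n) • jonesWenzl N n :=
  headTrace_jonesWenzl_of_idempotent (jonesWenzl_idempotent hN n)

theorem jonesWenzl_mul_consId (hN : 3 ≤ N) (n : ℕ) :
    jonesWenzl N (n + 1) * consId (jonesWenzl N n) = jonesWenzl N (n + 1) :=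
  jonesWenzl_mul_consId_of_idempotent (jonesWenzl_idempotent hN n)

theorem jonesWenzl_transpose : ∀ n, (jonesWenzl N n)ᵀ = jonesWenzl N n
  | 0 => by simp [jonesWenzl]
  | 1 => by simp [jonesWenzl]
  | n + 2 => by
    rw [jonesWenzl_add_two]
    simp only [Matrix.transpose_sub, Matrix.transpose_smul, Matrix.transpose_mul,
      consId_transpose, jonesWenzl_transpose (n + 1), Matrix.transpose_transpose, Matrix.mul_assoc]

theorem cup_conjTranspose (n : ℕ) : (cup N n)ᴴ = (cup N n)ᵀ := by
  ext x y
  simp only [Matrix.conjTranspose_apply, Matrix.transpose_apply, cup, Matrix.of_apply]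
  split_ifs <;> simp

theorem cup_transpose_conjTranspose (n : ℕ) : ((cup N n)ᵀ)ᴴ = cup N n := by
  rw [← cup_conjTranspose, Matrix.conjTranspose_conjTranspose]

theorem jonesWenzl_conjTranspose : ∀ n, (jonesWenzl N n)ᴴ = jonesWenzl N n
  | 0 => by simp [jonesWenzl]
  | 1 => by simp [jonesWenzl]
  | n + 2 => by
    have h : star (wenzlCoeff N (n + 1)) = wenzlCoeff N (n + 1) := Complex.conj_ofReal _
    rw [jonesWenzl_add_two]
    simp only [Matrix.conjTranspose_sub, Matrix.conjTranspose_smul, Matrix.conjTranspose_mul, h,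
      consId_conjTranspose, jonesWenzl_conjTranspose (n + 1), cup_conjTranspose,
      cup_transpose_conjTranspose, Matrix.mul_assoc]

theorem consId_mul_jonesWenzl (hN : 3 ≤ N) (n : ℕ) :
    consId (jonesWenzl N n) * jonesWenzl N (n + 1) = jonesWenzl N (n + 1) := by
  have h := congrArg Matrix.transpose (jonesWenzl_mul_consId hN n)
  rwa [Matrix.transpose_mul, consId_transpose, jonesWenzl_transpose, jonesWenzl_transpose] at h

/-- With the same notation, `T* P T T* P = g T* P`, and `w g = 1` makes the two terms of the
recursion cancel. -/
theorem cup_transpose_mul_jonesWenzl (hN : 3 ≤ N) (n : ℕ) :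
    (cup N n)ᵀ * jonesWenzl N (n + 2) = 0 := by
  have h2 := cup_transpose_mul_consId_mul_cup (jonesWenzl N (n + 1))
  rw [headTrace_jonesWenzl hN] at h2
  have h3 : jonesWenzl N n * ((cup N n)ᵀ * consId (jonesWenzl N (n + 1))) =
      (cup N n)ᵀ * consId (jonesWenzl N (n + 1)) := by
    rw [← Matrix.mul_assoc, mul_cup_transpose, Matrix.mul_assoc, ← consId_mul,
      consId_mul_jonesWenzl hN]
  have h4 := natCast_sub_wenzlCoeff_mul hN n
  rw [jonesWenzl_add_two, Matrix.mul_sub, Matrix.mul_smul]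
  have h5 : (cup N n)ᵀ * (consId (jonesWenzl N (n + 1)) * (cup N n * (cup N n)ᵀ) *
      consId (jonesWenzl N (n + 1))) = ((cup N n)ᵀ * consId (jonesWenzl N (n + 1)) * cup N n) *
        ((cup N n)ᵀ * consId (jonesWenzl N (n + 1))) := by simp only [Matrix.mul_assoc]
  rw [h5, h2, Matrix.smul_mul, h3, smul_smul, mul_comm, h4, one_smul, sub_self]

/-- The recursion treats the first pair of legs; for a later pair, `p_{n+2}` absorbs `ι ⊗ p_{n+1}`,
to which induction applies. -/
theorem cupCap_mul_jonesWenzl (hN : 3 ≤ N) :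
    ∀ (n a : ℕ) (ha : a + 1 < n), cupCap N n a ha * jonesWenzl N n = 0
  | 0, a, ha => by omega
  | 1, a, ha => by omega
  | n + 2, 0, ha => by
    rw [cupCap_zero, Matrix.mul_assoc, cup_transpose_mul_jonesWenzl hN, Matrix.mul_zero]
  | n + 2, a + 1, ha => by
    rw [cupCap_succ (by omega), ← consId_mul_jonesWenzl hN, ← Matrix.mul_assoc, ← consId_mul,
      cupCap_mul_jonesWenzl hN (n + 1) a (by omega), consId_zero, Matrix.zero_mul]

/-! ### Intertwiners -/

theorem IsIntertwiner.mul {A ι : Type*} [Ring A] [Algebra ℂ A] [Fintype ι]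
    {U : Matrix ι ι A} {S T : Matrix ι ι ℂ} (hS : IsIntertwiner U U S) (hT : IsIntertwiner U U T) :
    IsIntertwiner U U (S * T) := by
  unfold IsIntertwiner at *
  rw [Matrix.map_mul, Matrix.mul_assoc, hT, ← Matrix.mul_assoc, hS, Matrix.mul_assoc]

theorem IsIntertwiner.sub {A ι : Type*} [Ring A] [Algebra ℂ A] [Fintype ι]
    {U : Matrix ι ι A} {S T : Matrix ι ι ℂ} (hS : IsIntertwiner U U S) (hT : IsIntertwiner U U T) :
    IsIntertwiner U U (S - T) := by
  unfold IsIntertwiner at *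
  rw [Matrix.map_sub _ (map_sub _), Matrix.sub_mul, hT, hS, Matrix.mul_sub]

theorem IsIntertwiner.smul {A ι : Type*} [Ring A] [Algebra ℂ A] [Fintype ι]
    {U : Matrix ι ι A} {T : Matrix ι ι ℂ} (z : ℂ) (hT : IsIntertwiner U U T) :
    IsIntertwiner U U (z • T) := by
  unfold IsIntertwiner at *
  have : (z • T).map (algebraMap ℂ A) = z • T.map (algebraMap ℂ A) := by
    ext x y; simp [Algebra.smul_def]
  rw [this, Matrix.smul_mul, hT, Matrix.mul_smul]

theorem IsIntertwiner.one {A ι : Type*} [Ring A] [Algebra ℂ A] [Fintype ι] [DecidableEq ι]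
    (U : Matrix ι ι A) : IsIntertwiner U U 1 := by
  unfold IsIntertwiner
  rw [Matrix.map_one _ (map_zero _) (map_one _), Matrix.one_mul, Matrix.mul_one]

theorem tensorRep_cons {n : ℕ} (s t : Fin N) (x y : Fin n → Fin N) :
    tensorRep N (n + 1) (Fin.cons s x) (Fin.cons t y) = fundRep N s t * tensorRep N n x y := by
  simp [tensorRep, List.ofFn_succ]

theorem sum_fundRep_row (i j : Fin N) :
    ∑ k, fundRep N i k * fundRep N j k = if i = j then 1 else 0 := by
  have h := RingQuot.mkAlgHom_rel ℂ (OrthRel.row i j)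
  rw [map_sum, apply_ite (RingQuot.mkAlgHom ℂ (OrthRel N))] at h
  simpa [fundRep] using h

theorem sum_fundRep_col (i j : Fin N) :
    ∑ k, fundRep N k i * fundRep N k j = if i = j then 1 else 0 := by
  have h := RingQuot.mkAlgHom_rel ℂ (OrthRel.col i j)
  rw [map_sum, apply_ite (RingQuot.mkAlgHom ℂ (OrthRel N))] at h
  simpa [fundRep] using h

theorem isIntertwiner_consId {n : ℕ} {T : Matrix (Fin n → Fin N) (Fin n → Fin N) ℂ}
    (hT : IsIntertwiner (tensorRep N n) (tensorRep N n) T) :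
    IsIntertwiner (tensorRep N (n + 1)) (tensorRep N (n + 1)) (consId T) := by
  unfold IsIntertwiner at *
  ext x y
  revert x y
  refine word_cases fun s x => word_cases fun t y => ?_
  have h := congrFun (congrFun hT x) y
  simp only [Matrix.mul_apply, Matrix.map_apply] at h
  simp only [Matrix.mul_apply, Matrix.map_apply, sum_word_succ, consId_cons, tensorRep_cons]
  rw [Finset.sum_eq_single s (by intro u _ hu; simp [hu.symm]) (by simp),
    Finset.sum_eq_single t (by intro u _ hu; simp [hu]) (by simp)]
  simp only [if_true, mul_assoc, ← Finset.mul_sum, ← h]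
  rw [Finset.mul_sum]
  refine Finset.sum_congr rfl fun z _ => ?_
  rw [← mul_assoc, Algebra.commutes, mul_assoc]

/-- Both composites equal `T_1 T_1* ⊗ u^{⊗n}`: the column relations collapse one of them, the row
relations the other. -/
theorem isIntertwiner_cup_mul_cup_transpose (n : ℕ) :
    IsIntertwiner (tensorRep N (n + 2)) (tensorRep N (n + 2)) (cup N n * (cup N n)ᵀ) := by
  have key : ∀ (s s' t t' : Fin N) (x y : Fin n → Fin N),
      (cup N n * (cup N n)ᵀ) (Fin.cons s (Fin.cons s' x : Fin (n + 1) → Fin N) : Fin (n + 2) → Fin N)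
        (Fin.cons t (Fin.cons t' y : Fin (n + 1) → Fin N) : Fin (n + 2) → Fin N) =
      if s = s' then if t = t' then if x = y then 1 else 0 else 0 else 0 := by
    intro s s' t t' x y
    simp only [Matrix.mul_apply, cup_cons, Matrix.transpose_apply]
    rw [Finset.sum_eq_single x (by intro u _ hu; simp [hu.symm]) (by simp)]
    simp only [and_true, ite_and, eq_comm (a := x)]
    split_ifs <;> simp
  unfold IsIntertwiner
  ext x y
  revert x y
  refine word_cases fun s => word_cases fun s' x => word_cases fun t => word_cases fun t' y => ?_
  rw [Matrix.mul_apply, Matrix.mul_apply]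
  have e1 : (∑ u, if s = s' then fundRep N u t * (fundRep N u t' * tensorRep N n x y) else 0) =
      if s = s' then if t = t' then tensorRep N n x y else 0 else 0 := by
    split_ifs with h1 h2
    · simp only [← mul_assoc, ← Finset.sum_mul, sum_fundRep_col, h2, if_true, one_mul]
    · simp only [← mul_assoc, ← Finset.sum_mul, sum_fundRep_col, h2, if_false, zero_mul]
    · simp
  have e2 : (∑ u, if t = t' then fundRep N s u * (fundRep N s' u * tensorRep N n x y) else 0) =
      if s = s' then if t = t' then tensorRep N n x y else 0 else 0 := by
    by_cases h2 : t = t'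
    · simp only [← mul_assoc, ← Finset.sum_mul, sum_fundRep_row, h2, if_true]
      split_ifs <;> simp
    · simp [h2]
  simp only [sum_word_succ, Matrix.map_apply, tensorRep_cons]
  refine Eq.trans (Finset.sum_congr rfl fun u _ => ?_)
    (e1.trans (e2.symm.trans (Finset.sum_congr rfl fun u _ => ?_)))
  · rw [Finset.sum_eq_single u (by intro v _ hv; simp [key, hv.symm]) (by simp),
      Finset.sum_eq_single x (by intro z _ hz; simp [key, hz.symm]) (by simp), key]
    split_ifs <;> simp_all
  · rw [Finset.sum_eq_single u (by intro v _ hv; simp [key, hv.symm]) (by simp),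
      Finset.sum_eq_single y (by intro z _ hz; simp [key, hz]) (by simp), key]
    split_ifs <;> simp_all

theorem isIntertwiner_jonesWenzl :
    ∀ n, IsIntertwiner (tensorRep N n) (tensorRep N n) (jonesWenzl N n)
  | 0 => IsIntertwiner.one _
  | 1 => IsIntertwiner.one _
  | n + 2 => by
    have h := isIntertwiner_consId (isIntertwiner_jonesWenzl (n + 1))
    rw [jonesWenzl_add_two]
    exact h.sub (((h.mul (isIntertwiner_cup_mul_cup_transpose n)).mul h).smul _)

/-! ### The range of the Jones-Wenzl projection -/

/-- `v` is annihilated by `T₁*` on every pair of neighbouring legs. -/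
def TurnbackFree {n : ℕ} (v : (Fin n → Fin N) → ℂ) : Prop :=
  ∀ (s t : Fin n), (t.val = s.val + 1 ∨ s.val = t.val + 1) → ∀ y : Fin N → Fin n → Fin N,
    (∀ b, y b s = b) → (∀ b, y b t = b) → (∀ b c u, u ≠ s → u ≠ t → y b u = y c u) →
    ∑ b, v (y b) = 0

theorem turnbackFree_of_cupCap {n : ℕ} {v : (Fin n → Fin N) → ℂ}
    (h : ∀ a ha, cupCap N n a ha *ᵥ v = 0) : TurnbackFree v := by
  suffices H : ∀ (s t : Fin n), t.val = s.val + 1 → ∀ y : Fin N → Fin n → Fin N,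
      (∀ b, y b s = b) → (∀ b, y b t = b) → (∀ b c u, u ≠ s → u ≠ t → y b u = y c u) →
      ∑ b, v (y b) = 0 by
    intro s t hst y hs ht hu
    rcases hst with hst | hst
    · exact H s t hst y hs ht hu
    · exact H t s hst y ht hs fun b c u h1 h2 => hu b c u h2 h1
  intro s t hst y hs ht hu
  rcases isEmpty_or_nonempty (Fin N) with hE | ⟨⟨b0⟩⟩
  · simp
  have ha : s.val + 1 < n := hst ▸ t.isLt
  have ht' : (⟨s.val + 1, ha⟩ : Fin n) = t := Fin.ext hst.symm
  have h1 := congrFun (h s.val ha) (y b0)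
  refine Eq.trans (Eq.symm ?_) h1
  simp only [Matrix.mulVec, dotProduct, cupCap, Matrix.of_apply, ht', Fin.eta, hs, ht, true_and,
    ite_mul, one_mul, zero_mul]
  rw [← Finset.sum_filter]
  symm
  -- The words contributing to the entry of `cupCap *ᵥ v` at `y b0` are exactly the members of the
  -- family `y`.
  refine Finset.sum_bij (fun b _ => y b) ?_ ?_ ?_ (fun _ _ => rfl)
  · intro b _
    simp only [Finset.mem_filter, Finset.mem_univ, true_and, hs, ht]
    exact fun u h1 h2 => hu _ _ u (fun h => h1 (congrArg Fin.val h))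
      (fun h => h2 (by rw [h, hst]))
  · intro b _ c _ hbc
    rw [← hs b, ← hs c, hbc]
  · intro z hz
    simp only [Finset.mem_filter, Finset.mem_univ, true_and] at hz
    refine ⟨z s, Finset.mem_univ _, funext fun u => ?_⟩
    by_cases h1 : u = s
    · rw [h1, hs]
    by_cases h2 : u = t
    · rw [h2, ht, hz.1]
    · rw [hu _ b0 u h1 h2]
      exact hz.2 u (fun h => h1 (Fin.ext h)) (fun h => h2 (Fin.ext (h.trans hst.symm)))

theorem turnbackFree_jonesWenzl_mulVec (hN : 3 ≤ N) {n : ℕ} (v : (Fin n → Fin N) → ℂ) :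
    TurnbackFree (jonesWenzl N n *ᵥ v) :=
  turnbackFree_of_cupCap fun a ha => by
    rw [Matrix.mulVec_mulVec, cupCap_mul_jonesWenzl hN, Matrix.zero_mulVec]

theorem consId_mulVec_cons {a b : ℕ} (X : Matrix (Fin a → Fin N) (Fin b → Fin N) ℂ)
    (v : (Fin (b + 1) → Fin N) → ℂ) (s : Fin N) (x : Fin a → Fin N) :
    (consId X *ᵥ v) (Fin.cons s x : Fin (a + 1) → Fin N) =
      (X *ᵥ fun z => v (Fin.cons s z : Fin (b + 1) → Fin N)) x := by
  simp only [Matrix.mulVec, dotProduct, sum_word_succ, consId_cons]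
  rw [Finset.sum_eq_single s (by intro u _ hu; simp [hu.symm]) (by simp)]
  simp

theorem cup_transpose_mulVec {n : ℕ} (v : (Fin (n + 2) → Fin N) → ℂ) (x : Fin n → Fin N) :
    ((cup N n)ᵀ *ᵥ v) x =
      ∑ b, v (Fin.cons b (Fin.cons b x : Fin (n + 1) → Fin N) : Fin (n + 2) → Fin N) := by
  simp only [Matrix.mulVec, dotProduct, sum_word_succ, Matrix.transpose_apply, cup_cons]
  refine Finset.sum_congr rfl fun s _ => ?_
  rw [Finset.sum_eq_single s (by intro u _ hu; simp [hu.symm]) (by simp),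
    Finset.sum_eq_single x (by intro u _ hu; simp [hu]) (by simp)]
  simp

theorem TurnbackFree.cons {n : ℕ} {v : (Fin (n + 1) → Fin N) → ℂ} (hv : TurnbackFree v)
    (a : Fin N) : TurnbackFree fun x => v (Fin.cons a x : Fin (n + 1) → Fin N) := by
  intro s t hst y hs ht hu
  refine hv s.succ t.succ (by simpa using hst) (fun b => Fin.cons a (y b)) (by simpa using hs)
    (by simpa using ht) fun b c u => ?_
  refine Fin.cases (by simp) (fun u h1 h2 => ?_) u
  simpa using hu b c u (fun h => h1 (h ▸ rfl)) (fun h => h2 (h ▸ rfl))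

theorem TurnbackFree.cup_transpose_mulVec {n : ℕ} {v : (Fin (n + 2) → Fin N) → ℂ}
    (hv : TurnbackFree v) : (cup N n)ᵀ *ᵥ v = 0 := by
  funext x
  rw [FreeOrth.cup_transpose_mulVec]
  refine hv 0 (Fin.succ 0) (Or.inl rfl)
    (fun b => Fin.cons b (Fin.cons b x : Fin (n + 1) → Fin N)) (fun _ => rfl) (fun _ => rfl)
    fun b c u => ?_
  refine Fin.cases (by simp) (fun u => ?_) u
  refine Fin.cases (by simp) (fun u _ _ => rfl) u

theorem jonesWenzl_add_two_mulVec {n : ℕ} {v : (Fin (n + 2) → Fin N) → ℂ}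
    (h1 : consId (jonesWenzl N (n + 1)) *ᵥ v = v) (h2 : (cup N n)ᵀ *ᵥ v = 0) :
    jonesWenzl N (n + 2) *ᵥ v = v := by
  rw [jonesWenzl_add_two, Matrix.sub_mulVec, Matrix.smul_mulVec, ← Matrix.mulVec_mulVec, h1,
    ← Matrix.mulVec_mulVec, ← Matrix.mulVec_mulVec, h2, Matrix.mulVec_zero, Matrix.mulVec_zero,
    smul_zero, sub_zero]

/-- Fixing the first letter leaves a turnback-free vector, so by induction `ι ⊗ p_{n+1}` fixes `v`;
the correction term then contains `T* v = 0`. Together with `turnbackFree_jonesWenzl_mulVec` this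
identifies the range of `p_n`. -/
theorem TurnbackFree.jonesWenzl_mulVec :
    ∀ {n : ℕ} {v : (Fin n → Fin N) → ℂ}, TurnbackFree v → jonesWenzl N n *ᵥ v = v
  | 0, v, _ => by rw [jonesWenzl, Matrix.one_mulVec]
  | 1, v, _ => by rw [jonesWenzl, Matrix.one_mulVec]
  | n + 2, v, hv => by
    refine jonesWenzl_add_two_mulVec (funext (word_cases fun a x => ?_)) hv.cup_transpose_mulVec
    rw [consId_mulVec_cons, TurnbackFree.jonesWenzl_mulVec (hv.cons a)]

theorem TurnbackFree.rev {n : ℕ} {v : (Fin n → Fin N) → ℂ} (hv : TurnbackFree v) :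
    TurnbackFree fun x => v (x ∘ Fin.rev) := by
  intro s t hst y hs ht hu
  refine hv s.rev t.rev ?_ (fun b => y b ∘ Fin.rev) (by simpa using hs) (by simpa using ht)
    fun b c u h1 h2 => hu b c _ (fun h => h1 (by rw [← h, Fin.rev_rev]))
      (fun h => h2 (by rw [← h, Fin.rev_rev]))
  simp only [Fin.val_rev]
  omega

theorem comp_rev_rev {n : ℕ} (x : Fin n → Fin N) : (x ∘ Fin.rev) ∘ Fin.rev = x := by
  funext u; simp

theorem jonesWenzl_mul_of_turnbackFree {n : ℕ} {κ : Type*} [Fintype κ]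
    {X : Matrix (Fin n → Fin N) κ ℂ} (h : ∀ y, TurnbackFree fun x => X x y) :
    jonesWenzl N n * X = X := by
  ext x y
  exact congrFun (h y).jonesWenzl_mulVec x

theorem mul_jonesWenzl_of_turnbackFree {n : ℕ} {κ : Type*} [Fintype κ]
    {X : Matrix κ (Fin n → Fin N) ℂ} (h : ∀ x, TurnbackFree (X x)) :
    X * jonesWenzl N n = X := by
  have := congrArg Matrix.transpose (jonesWenzl_mul_of_turnbackFree (X := Xᵀ) h)
  rwa [Matrix.transpose_mul, jonesWenzl_transpose] at this

theorem turnbackFree_jonesWenzl_col (hN : 3 ≤ N) {n : ℕ} (y : Fin n → Fin N) :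
    TurnbackFree fun x => jonesWenzl N n x y := by
  have h := turnbackFree_jonesWenzl_mulVec hN (Pi.single y 1)
  rwa [Matrix.mulVec_single_one] at h

/-- The Wenzl recursion favours the left end, but turnback-freeness is symmetric. With `p'` the
reversal of `p`, this gives `p p' = p'`; reversing and transposing gives `p p' = p`. -/
theorem jonesWenzl_rev (hN : 3 ≤ N) {n : ℕ} (x y : Fin n → Fin N) :
    jonesWenzl N n (x ∘ Fin.rev) (y ∘ Fin.rev) = jonesWenzl N n x y := by
  let e : (Fin n → Fin N) ≃ (Fin n → Fin N) :=
    ⟨fun x => x ∘ Fin.rev, fun x => x ∘ Fin.rev, comp_rev_rev, comp_rev_rev⟩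
  have h1 : jonesWenzl N n * (jonesWenzl N n).submatrix e e = (jonesWenzl N n).submatrix e e :=
    jonesWenzl_mul_of_turnbackFree fun y => (turnbackFree_jonesWenzl_col hN (e y)).rev
  have h2 := congrArg (fun M => M.submatrix e e) h1
  simp only [← Matrix.submatrix_mul_equiv _ _ e e e, Matrix.submatrix_submatrix] at h2
  have h3 : e ∘ e = id := funext comp_rev_rev
  rw [h3, Matrix.submatrix_id_id] at h2
  have h4 := congrArg Matrix.transpose h2
  rw [Matrix.transpose_mul, Matrix.transpose_submatrix, jonesWenzl_transpose, h1] at h4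
  exact congrFun (congrFun h4 x) y

/-! ### Vectors of a tensor product as matrices, with the left word reversed -/

/-- A vector of `H_1^{⊗ (i + j)}` as a matrix, with the first `i` letters reversed. -/
def splitRev {i j : ℕ} (v : (Fin (i + j) → Fin N) → ℂ) :
    Matrix (Fin i → Fin N) (Fin j → Fin N) ℂ :=
  Matrix.of fun x y => v (Fin.append (x ∘ Fin.rev) y)

theorem TurnbackFree.jonesWenzl_mul_splitRev {i j : ℕ} {v : (Fin (i + j) → Fin N) → ℂ}
    (hv : TurnbackFree v) : jonesWenzl N i * splitRev v = splitRev v := by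
  refine jonesWenzl_mul_of_turnbackFree fun z => TurnbackFree.rev (v := fun x => v (Fin.append x z)) ?_
  intro s t hst y hs ht hu
  refine hv (s.castAdd j) (t.castAdd j) (by simpa using hst) (fun b => Fin.append (y b) z)
    (by simpa using hs) (by simpa using ht) fun b c u => ?_
  refine Fin.addCases (fun u h1 h2 => ?_) (fun u _ _ => by simp) u
  simpa using hu b c u (fun h => h1 (h ▸ rfl)) (fun h => h2 (h ▸ rfl))

theorem TurnbackFree.splitRev_mul_jonesWenzl {i j : ℕ} {v : (Fin (i + j) → Fin N) → ℂ}
    (hv : TurnbackFree v) : splitRev v * jonesWenzl N j = splitRev v := by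
  refine mul_jonesWenzl_of_turnbackFree fun x => ?_
  intro s t hst y hs ht hu
  refine hv (s.natAdd i) (t.natAdd i) ?_ (fun b => Fin.append (x ∘ Fin.rev) (y b))
    (by simpa using hs) (by simpa using ht) fun b c u => ?_
  · simp only [Fin.val_natAdd]; omega
  refine Fin.addCases (fun u _ _ => by simp) (fun u h1 h2 => ?_) u
  simpa using hu b c u (fun h => h1 (h ▸ rfl)) (fun h => h2 (h ▸ rfl))

/-- After the reversal, the first row letter and the first column letter are the two neighbours of
the cut, so the partial trace is `T_1*` at the cut. -/
theorem TurnbackFree.headTrace_splitRev {i j : ℕ} {v : (Fin (i + 1 + (j + 1)) → Fin N) → ℂ}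
    (hv : TurnbackFree v) : headTrace (splitRev v) = 0 := by
  ext x z
  refine hv ((Fin.last i).castAdd _) ((0 : Fin (j + 1)).natAdd _) (by simp)
    (fun b => Fin.append ((Fin.cons b x : Fin (i + 1) → Fin N) ∘ Fin.rev) (Fin.cons b z))
    (by simp) (fun b => by rw [Fin.append_right, Fin.cons_zero]) fun b c u => ?_
  refine Fin.addCases (fun u h1 _ => ?_) (fun u _ h2 => ?_) u
  · simp only [Fin.append_left, Function.comp_apply]
    obtain ⟨w, hw⟩ : ∃ w, u.rev = Fin.succ w := Fin.eq_succ_of_ne_zero fun h => h1 <| by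
      have hu : u = Fin.last i := by rw [← Fin.rev_rev u, h, Fin.rev_zero]
      rw [hu]
    rw [hw, Fin.cons_succ, Fin.cons_succ]
  · simp only [Fin.append_right]
    obtain ⟨w, hw⟩ : ∃ w, u = Fin.succ w := Fin.eq_succ_of_ne_zero fun h => h2 (congrArg _ h)
    rw [hw, Fin.cons_succ, Fin.cons_succ]

/-! ### Three-vertices -/

section vertex

variable {a b : ℕ}

/-- Expanding both projections leaves four terms. Three have partial traces `N X`, `w X` and `w' X`;
in the fourth, `T* (ι ⊗ X) T` is the partial trace of `X`. -/
theorem headTrace_vertex_succ_succ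
    {X : Matrix (Fin (a + 1) → Fin N) (Fin (b + 1) → Fin N) ℂ}
    (h1 : jonesWenzl N (a + 1) * X = X) (h2 : X * jonesWenzl N (b + 1) = X) :
    headTrace (jonesWenzl N (a + 2) * consId X * jonesWenzl N (b + 2)) =
      ((N : ℂ) - wenzlCoeff N (a + 1) - wenzlCoeff N (b + 1)) • X +
        (wenzlCoeff N (a + 1) * wenzlCoeff N (b + 1)) •
          (jonesWenzl N (a + 1) * consId (headTrace X) * jonesWenzl N (b + 1)) := by
  have h1' := congrArg consId h1
  have h2' := congrArg consId h2
  rw [consId_mul] at h1' h2'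
  rw [jonesWenzl_add_two, jonesWenzl_add_two]
  set w := wenzlCoeff N (a + 1)
  set w' := wenzlCoeff N (b + 1)
  have e : (consId (jonesWenzl N (a + 1)) - w • (consId (jonesWenzl N (a + 1)) *
      (cup N a * (cup N a)ᵀ) * consId (jonesWenzl N (a + 1)))) * consId X *
      (consId (jonesWenzl N (b + 1)) - w' • (consId (jonesWenzl N (b + 1)) *
      (cup N b * (cup N b)ᵀ) * consId (jonesWenzl N (b + 1)))) =
      consId X - w • (consId (jonesWenzl N (a + 1)) * ((cup N a * (cup N a)ᵀ) * consId X)) -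
      w' • ((consId X * (cup N b * (cup N b)ᵀ)) * consId (jonesWenzl N (b + 1))) +
      (w * w') • (consId (jonesWenzl N (a + 1)) * ((cup N a * headTrace X * (cup N b)ᵀ) *
        consId (jonesWenzl N (b + 1)))) := by
    rw [← cup_transpose_mul_consId_mul_cup]
    rw [Matrix.sub_mul, h1', Matrix.smul_mul, Matrix.mul_assoc (_ * _) (consId _) (consId X), h1',
      Matrix.mul_sub, Matrix.sub_mul, Matrix.sub_mul, h2', Matrix.smul_mul, Matrix.mul_smul,
      Matrix.smul_mul, Matrix.mul_smul, Matrix.mul_assoc _ (consId X) (consId _), h2',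
      ← Matrix.mul_assoc (consId X), ← Matrix.mul_assoc (consId X), h2', smul_smul]
    have e2 : consId (jonesWenzl N (a + 1)) * (cup N a * (cup N a)ᵀ) * consId X *
        (consId (jonesWenzl N (b + 1)) * (cup N b * (cup N b)ᵀ) *
          consId (jonesWenzl N (b + 1))) =
        consId (jonesWenzl N (a + 1)) * (cup N a * (cup N a)ᵀ) *
          (consId X * consId (jonesWenzl N (b + 1))) * (cup N b * (cup N b)ᵀ) *
          consId (jonesWenzl N (b + 1)) := by simp only [Matrix.mul_assoc]
    rw [e2, h2']
    simp only [Matrix.mul_assoc]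
    abel
  rw [e]
  simp only [headTrace_add, headTrace_sub, headTrace_smul, headTrace_consId_mul,
    headTrace_mul_consId, headTrace_cup_mul_cup_transpose, headTrace_cup_mul_mul_cup_transpose,
    headTrace_consId, Matrix.one_mul, Matrix.mul_one, h1, h2, sub_smul]
  rw [Matrix.mul_assoc]

theorem headTrace_vertex_zero_left (hN : 3 ≤ N)
    {X : Matrix (Fin 0 → Fin N) (Fin b → Fin N) ℂ} (h2 : X * jonesWenzl N b = X) :
    headTrace (jonesWenzl N 1 * consId X * jonesWenzl N (b + 1)) =
      ((N : ℂ) - wenzlCoeff N b) • X := by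
  rw [jonesWenzl, Matrix.one_mul, headTrace_consId_mul, headTrace_jonesWenzl hN, Matrix.mul_smul,
    h2]

theorem headTrace_vertex_zero_right (hN : 3 ≤ N)
    {X : Matrix (Fin a → Fin N) (Fin 0 → Fin N) ℂ} (h1 : jonesWenzl N a * X = X) :
    headTrace (jonesWenzl N (a + 1) * consId X * jonesWenzl N 1) =
      ((N : ℂ) - wenzlCoeff N a) • X := by
  rw [jonesWenzl.eq_2, Matrix.mul_one, headTrace_mul_consId, headTrace_jonesWenzl hN,
    Matrix.smul_mul, h1]

/-- The cap at the cut kills the fourth term. The cases `i = 0` and `j = 0` are separate because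
`p_1` is not given by the recursion; `[0] = 0` makes the formula uniform. -/
theorem TurnbackFree.headTrace_vertex_splitRev (hN : 3 ≤ N) :
    ∀ {i j : ℕ} {v : (Fin (i + j) → Fin N) → ℂ}, TurnbackFree v →
    headTrace (jonesWenzl N (i + 1) * consId (splitRev v) * jonesWenzl N (j + 1)) =
      ((N : ℂ) - wenzlCoeff N i - wenzlCoeff N j) • splitRev v
  | 0, j, v, hv => by
    rw [headTrace_vertex_zero_left hN hv.splitRev_mul_jonesWenzl, wenzlCoeff_zero, sub_zero]
  | i + 1, 0, v, hv => by
    rw [headTrace_vertex_zero_right hN hv.jonesWenzl_mul_splitRev, wenzlCoeff_zero, sub_zero]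
  | i + 1, j + 1, v, hv => by
    rw [headTrace_vertex_succ_succ hv.jonesWenzl_mul_splitRev hv.splitRev_mul_jonesWenzl,
      hv.headTrace_splitRev, consId_zero, Matrix.mul_zero, Matrix.zero_mul, smul_zero, add_zero]

/-- `r` nested cups inserted between the two factors. -/
def insertMatrix (X : Matrix (Fin a → Fin N) (Fin b → Fin N) ℂ) :
    (r : ℕ) → Matrix (Fin (a + r) → Fin N) (Fin (b + r) → Fin N) ℂ
  | 0 => X
  | r + 1 => consId (insertMatrix X r)

/-- The matrix of the image of a vector under the three-vertex. -/
def vertexMatrix (X : Matrix (Fin a → Fin N) (Fin b → Fin N) ℂ) (r : ℕ) :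
    Matrix (Fin (a + r) → Fin N) (Fin (b + r) → Fin N) ℂ :=
  jonesWenzl N (a + r) * insertMatrix X r * jonesWenzl N (b + r)

/-- Each outer projection absorbs `ι ⊗ p` of the size below, so inner projections may be inserted
freely. -/
theorem vertexMatrix_succ (hN : 3 ≤ N) (X : Matrix (Fin a → Fin N) (Fin b → Fin N) ℂ) (r : ℕ) :
    vertexMatrix X (r + 1) =
      jonesWenzl N (a + r + 1) * consId (vertexMatrix X r) * jonesWenzl N (b + r + 1) := by
  rw [vertexMatrix, vertexMatrix, consId_mul, consId_mul, ← Matrix.mul_assoc, ← Matrix.mul_assoc,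
    jonesWenzl_mul_consId hN, Matrix.mul_assoc _ (consId _) (jonesWenzl _ _),
    consId_mul_jonesWenzl hN]
  rfl

theorem jonesWenzl_mul_vertexMatrix (hN : 3 ≤ N)
    (X : Matrix (Fin a → Fin N) (Fin b → Fin N) ℂ) (r : ℕ) :
    jonesWenzl N (a + r) * vertexMatrix X r = vertexMatrix X r := by
  rw [vertexMatrix, ← Matrix.mul_assoc, ← Matrix.mul_assoc, jonesWenzl_idempotent hN]

theorem vertexMatrix_mul_jonesWenzl (hN : 3 ≤ N)
    (X : Matrix (Fin a → Fin N) (Fin b → Fin N) ℂ) (r : ℕ) :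
    vertexMatrix X r * jonesWenzl N (b + r) = vertexMatrix X r := by
  rw [vertexMatrix, Matrix.mul_assoc, jonesWenzl_idempotent hN]

/-- The ratio of two successive squared norms of three-vertices. -/
def vertexRatio (N i j r : ℕ) : ℝ :=
  qInt (qParam N) (r + 1) * qInt (qParam N) (i + j + r + 2) /
    (qInt (qParam N) (i + r + 1) * qInt (qParam N) (j + r + 1))

/-- This form exposes the recursion in `r`: the last term is `w w'` times the preceding ratio, and
vanishes for `r = 0`. -/
theorem vertexRatio_eq (hN : 3 ≤ N) (i j r : ℕ) :
    vertexRatio N i j r = N - qInt (qParam N) (i + r) / qInt (qParam N) (i + r + 1) -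
      qInt (qParam N) (j + r) / qInt (qParam N) (j + r + 1) +
      qInt (qParam N) r * qInt (qParam N) (i + j + r + 1) /
        (qInt (qParam N) (i + r + 1) * qInt (qParam N) (j + r + 1)) := by
  obtain ⟨h0, h1, h2⟩ := qParam_spec hN
  have hq1 : qParam N < 1 := by linarith [show (0.3821 : ℝ) < 1 by norm_num]
  have e := qInt_mul_identity h0 hq1 i j r
  have p1 := (qInt_pos h0 hq1 (i + r)).ne'
  have p2 := (qInt_pos h0 hq1 (j + r)).ne'
  rw [vertexRatio]
  field_simp
  apply mul_left_cancel₀ h0.ne'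
  rw [e, h2]
  ring

theorem vertexRatio_zero (hN : 3 ≤ N) (i j : ℕ) :
    (vertexRatio N i j 0 : ℂ) = N - wenzlCoeff N i - wenzlCoeff N j := by
  rw [vertexRatio_eq hN, qInt_zero]
  simp [wenzlCoeff]

theorem vertexRatio_succ (hN : 3 ≤ N) (i j r : ℕ) :
    (vertexRatio N i j (r + 1) : ℂ) = N - wenzlCoeff N (i + r + 1) - wenzlCoeff N (j + r + 1) +
      wenzlCoeff N (i + r + 1) * wenzlCoeff N (j + r + 1) * vertexRatio N i j r := by
  obtain ⟨h0, h1, h2⟩ := qParam_spec hN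
  have hq1 : qParam N < 1 := by linarith [show (0.3821 : ℝ) < 1 by norm_num]
  have p1 := (qInt_pos h0 hq1 (i + r)).ne'
  have p2 := (qInt_pos h0 hq1 (j + r)).ne'
  have p3 := (qInt_pos h0 hq1 (i + r + 1)).ne'
  have p4 := (qInt_pos h0 hq1 (j + r + 1)).ne'
  rw [vertexRatio_eq hN]
  simp only [wenzlCoeff, vertexRatio]
  norm_cast
  rw [show i + (r + 1) = i + r + 1 from rfl, show j + (r + 1) = j + r + 1 from rfl,
    show i + j + (r + 1) + 1 = i + j + r + 2 from rfl]
  congr 1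
  field_simp

theorem TurnbackFree.headTrace_vertexMatrix (hN : 3 ≤ N) {i j : ℕ}
    {v : (Fin (i + j) → Fin N) → ℂ} (hv : TurnbackFree v) (r : ℕ) :
    headTrace (vertexMatrix (splitRev v) (r + 1)) =
      (vertexRatio N i j r : ℂ) • vertexMatrix (splitRev v) r := by
  induction r with
  | zero =>
    have h : vertexMatrix (splitRev v) 0 = splitRev v := by
      change jonesWenzl N i * splitRev v * jonesWenzl N j = _
      rw [hv.jonesWenzl_mul_splitRev, hv.splitRev_mul_jonesWenzl]
    rw [vertexMatrix_succ hN, h, vertexRatio_zero hN]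
    exact hv.headTrace_vertex_splitRev hN
  | succ r ih =>
    rw [vertexMatrix_succ hN, vertexRatio_succ hN]
    refine (headTrace_vertex_succ_succ (jonesWenzl_mul_vertexMatrix hN _ (r + 1))
      (vertexMatrix_mul_jonesWenzl hN _ (r + 1))).trans ?_
    rw [ih, consId_smul, Matrix.mul_smul, Matrix.smul_mul, smul_smul, add_smul]
    congr 2
    exact (vertexMatrix_succ hN _ r).symm

/-- The projections of the left factor move across the trace and are absorbed by the right one; the
remaining `ι ⊗ ·` becomes a partial trace by adjunction. -/
theorem TurnbackFree.trace_vertexMatrix (hN : 3 ≤ N) {i j : ℕ}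
    {v w : (Fin (i + j) → Fin N) → ℂ} (hw : TurnbackFree w) (r : ℕ) :
    ((vertexMatrix (splitRev v) (r + 1))ᴴ * vertexMatrix (splitRev w) (r + 1)).trace =
      vertexRatio N i j r *
        ((vertexMatrix (splitRev v) r)ᴴ * vertexMatrix (splitRev w) r).trace := by
  have h1 := jonesWenzl_mul_vertexMatrix hN (splitRev w) (r + 1)
  have h2 := vertexMatrix_mul_jonesWenzl hN (splitRev w) (r + 1)
  rw [vertexMatrix_succ hN (splitRev v), Matrix.conjTranspose_mul, Matrix.conjTranspose_mul,
    jonesWenzl_conjTranspose, jonesWenzl_conjTranspose, Matrix.mul_assoc, Matrix.mul_assoc,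
    Matrix.trace_mul_comm, Matrix.mul_assoc]
  have h3 : jonesWenzl N (i + r + 1) * vertexMatrix (splitRev w) (r + 1) *
      jonesWenzl N (j + r + 1) = vertexMatrix (splitRev w) (r + 1) := by
    exact (congrArg (· * jonesWenzl N (j + (r + 1))) h1).trans h2
  rw [h3, trace_consId_conjTranspose_mul, hw.headTrace_vertexMatrix hN, Matrix.mul_smul,
    Matrix.trace_smul, smul_eq_mul]

/-- The squared norm of a three-vertex. -/
def vertexNormSq (N i j r : ℕ) : ℝ := ∏ s ∈ Finset.range r, vertexRatio N i j s

theorem TurnbackFree.trace_vertexMatrix_eq (hN : 3 ≤ N) {i j : ℕ}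
    {v w : (Fin (i + j) → Fin N) → ℂ} (hv : TurnbackFree v) (hw : TurnbackFree w) (r : ℕ) :
    ((vertexMatrix (splitRev v) r)ᴴ * vertexMatrix (splitRev w) r).trace =
      vertexNormSq N i j r * ((splitRev v)ᴴ * splitRev w).trace := by
  induction r with
  | zero =>
    have h : ∀ {v : (Fin (i + j) → Fin N) → ℂ}, TurnbackFree v →
        vertexMatrix (splitRev v) 0 = splitRev v := by
      intro v hv
      change jonesWenzl N i * splitRev v * jonesWenzl N j = _
      rw [hv.jonesWenzl_mul_splitRev, hv.splitRev_mul_jonesWenzl]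
    rw [h hv, h hw]
    simp [vertexNormSq]
  | succ r ih =>
    rw [hw.trace_vertexMatrix hN, ih, vertexNormSq, vertexNormSq, Finset.prod_range_succ]
    push_cast
    ring

end vertex

/-! ### Estimates for the constants -/

theorem one_sub_pow_pos {q : ℝ} (hq0 : 0 < q) (hq1 : q < 1) (s : ℕ) : 0 < 1 - q ^ (2 * (s + 1)) :=
  sub_pos.2 (pow_lt_one₀ hq0.le hq1 (by omega))

/-- The finite products of `1 - q^(2s)` are bounded below. -/
theorem one_sub_le_prod {q : ℝ} (hq0 : 0 < q) (hq1 : q < 1) (n : ℕ) :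
    1 - q ^ 2 / (1 - q ^ 2) ≤ ∏ s ∈ Finset.range n, (1 - q ^ (2 * (s + 1))) := by
  have hq2 : q ^ 2 < 1 := by nlinarith
  -- Weierstrass' inequality `∏ (1 - x_s) ≥ 1 - ∑ x_s`; the sum is then dominated by a geometric
  -- series.
  have h : 1 - ∑ s ∈ Finset.range n, q ^ (2 * (s + 1)) ≤
      ∏ s ∈ Finset.range n, (1 - q ^ (2 * (s + 1))) := by
    induction n with
    | zero => simp
    | succ n ih =>
      rw [Finset.prod_range_succ, Finset.sum_range_succ]
      have h1 : 0 ≤ ∑ s ∈ Finset.range n, q ^ (2 * (s + 1)) :=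
        Finset.sum_nonneg fun s _ => by positivity
      have h2 := one_sub_pow_pos hq0 hq1 n
      have h3 : 0 < q ^ (2 * (n + 1)) := by positivity
      nlinarith [mul_le_mul_of_nonneg_right ih h2.le]
  refine le_trans ?_ h
  have h4 : ∑ s ∈ Finset.range n, q ^ (2 * (s + 1)) ≤ q ^ 2 / (1 - q ^ 2) := by
    have h5 : HasSum (fun s : ℕ => q ^ 2 * (q ^ 2) ^ s) (q ^ 2 * (1 - q ^ 2)⁻¹) :=
      (hasSum_geometric_of_lt_one (by positivity) hq2).mul_left _
    rw [div_eq_mul_inv]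
    refine le_trans (le_of_eq ?_) (sum_le_hasSum (Finset.range n) (fun s _ => by positivity) h5)
    refine Finset.sum_congr rfl fun s _ => ?_
    rw [pow_mul, pow_succ']
  linarith

/-- Bounds for the infinite product `∏ 1 / (1 - q^(2s))` by a common bound of the partial
products. -/
theorem tprod_bounds {q : ℝ} (hq0 : 0 < q) (hq1 : q < 1) {c : ℝ} (hc : 0 < c)
    (hle : ∀ n, c ≤ ∏ s ∈ Finset.range n, (1 - q ^ (2 * (s + 1)))) :
    (∏' s : ℕ, 1 / (1 - q ^ (2 * (s + 1)))) ≤ c⁻¹ ∧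
    ∀ n, (∏ s ∈ Finset.range n, (1 - q ^ (2 * (s + 1))))⁻¹ ≤
      ∏' s : ℕ, 1 / (1 - q ^ (2 * (s + 1))) := by
  have h1 : ∀ s, 1 ≤ 1 / (1 - q ^ (2 * (s + 1))) := fun s => by
    rw [one_le_div (one_sub_pow_pos hq0 hq1 s)]
    linarith [show 0 < q ^ (2 * (s + 1)) by positivity]
  have e : ∀ n, ∏ s ∈ Finset.range n, 1 / (1 - q ^ (2 * (s + 1))) =
      (∏ s ∈ Finset.range n, (1 - q ^ (2 * (s + 1))))⁻¹ := fun n => by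
    rw [← Finset.prod_inv_distrib]
    simp only [one_div]
  have hb : ∀ n, ∏ s ∈ Finset.range n, 1 / (1 - q ^ (2 * (s + 1))) ≤ c⁻¹ := fun n => by
    rw [e]; exact inv_anti₀ hc (hle n)
  have hmono : Monotone fun t : Finset ℕ => ∏ s ∈ t, 1 / (1 - q ^ (2 * (s + 1))) :=
    Finset.prod_mono_set_of_one_le h1
  have hb' : ∀ t : Finset ℕ, ∏ s ∈ t, 1 / (1 - q ^ (2 * (s + 1))) ≤ c⁻¹ := fun t => by
    obtain ⟨n, hn⟩ := t.exists_nat_subset_range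
    exact (hmono hn).trans (hb n)
  have hP : HasProd (fun s : ℕ => 1 / (1 - q ^ (2 * (s + 1)))) (⨆ t : Finset ℕ,
      ∏ s ∈ t, 1 / (1 - q ^ (2 * (s + 1)))) :=
    tendsto_atTop_ciSup hmono ⟨c⁻¹, by rintro _ ⟨t, rfl⟩; exact hb' t⟩
  rw [hP.tprod_eq]
  refine ⟨ciSup_le hb', fun n => ?_⟩
  rw [← e]
  exact le_ciSup (f := fun t : Finset ℕ => ∏ s ∈ t, 1 / (1 - q ^ (2 * (s + 1))))
    ⟨c⁻¹, by rintro _ ⟨t, rfl⟩; exact hb' t⟩ (Finset.range n)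

theorem constC_sq {q : ℝ} (hq : 0 < 1 - q ^ 2)
    (hP : 0 ≤ ∏' s : ℕ, 1 / (1 - q ^ (2 * (s + 1)))) :
    constC q ^ 2 = (1 - q ^ 2)⁻¹ * (∏' s : ℕ, 1 / (1 - q ^ (2 * (s + 1)))) ^ 3 := by
  rw [constC, mul_pow, ← Real.rpow_natCast, ← Real.rpow_mul hq.le, ← Real.rpow_natCast (_ ^ _),
    ← Real.rpow_mul hP]
  norm_num
  exact Or.inl (Real.rpow_neg_one _)

theorem constC_bounds (hN : 3 ≤ N) :
    constC (qParam N) ^ 2 * qParam N < 1 ∧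
    ∀ n, ((∏ s ∈ Finset.range n, (1 - qParam N ^ (2 * (s + 1)))) ^ 2)⁻¹ ≤ constC (qParam N) ^ 2 := by
  obtain ⟨h0, h1, -⟩ := qParam_spec hN
  set q := qParam N
  have hq1 : q < 1 := by linarith [show (0.3821 : ℝ) < 1 by norm_num]
  have hq2 : q ^ 2 ≤ 0.1461 := by nlinarith
  have hq3 : 0 < 1 - q ^ 2 := by linarith [show (0.1461 : ℝ) < 1 by norm_num]
  -- The value `0.828` lies just below `1 - 0.1461 / 0.8539`; it bounds the infinite product `Q` by
  -- `1 / 0.828`. In the second claim, `Q² ≤ Q³ / (1 - q²)` suffices.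
  have hc : (0.828 : ℝ) ≤ 1 - q ^ 2 / (1 - q ^ 2) := by
    have : q ^ 2 / (1 - q ^ 2) ≤ 0.172 := by
      rw [div_le_iff₀ hq3]; linarith
    linarith
  obtain ⟨hP1, hP2⟩ := tprod_bounds h0 hq1 (by norm_num : (0 : ℝ) < 0.828)
    fun n => hc.trans (one_sub_le_prod h0 hq1 n)
  set Q := ∏' s : ℕ, 1 / (1 - q ^ (2 * (s + 1)))
  have hQ1 : 1 ≤ Q := by simpa using hP2 0
  have hQ0 : 0 ≤ Q := zero_le_one.trans hQ1
  have hinv : 1 ≤ (1 - q ^ 2)⁻¹ := (one_le_inv₀ hq3).2 (by nlinarith)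
  rw [constC_sq hq3 hQ0]
  refine ⟨?_, fun n => ?_⟩
  · have hQ3 : Q ^ 3 ≤ (0.828⁻¹ : ℝ) ^ 3 := pow_le_pow_left₀ hQ0 hP1 3
    rw [mul_assoc, inv_mul_lt_iff₀ hq3, mul_one]
    calc Q ^ 3 * q ≤ (0.828⁻¹ : ℝ) ^ 3 * 0.3821 := by gcongr
      _ < 1 - 0.1461 := by norm_num
      _ ≤ 1 - q ^ 2 := by linarith
  · rw [← inv_pow]
    have hp : 0 ≤ (∏ s ∈ Finset.range n, (1 - q ^ (2 * (s + 1))))⁻¹ :=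
      inv_nonneg.2 (Finset.prod_nonneg fun s _ => (one_sub_pow_pos h0 hq1 s).le)
    calc _ ≤ Q ^ 2 := pow_le_pow_left₀ hp (hP2 n) 2
      _ ≤ Q ^ 3 := pow_le_pow_right₀ hQ1 (by norm_num)
      _ ≤ _ := le_mul_of_one_le_left (by positivity) hinv

/-- The powers of `q` in the four quantum integers combine to `1 / q`. The denominator factors are
at most one, and the larger index in the numerator gives the larger factor. -/
theorem vertexRatio_lower (hN : 3 ≤ N) (i j r : ℕ) :
    (1 - qParam N ^ (2 * (r + 1))) ^ 2 / qParam N ≤ vertexRatio N i j r := by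
  obtain ⟨h0, h1, -⟩ := qParam_spec hN
  rw [vertexRatio]
  set q := qParam N
  have hq1 : q < 1 := by linarith [show (0.3821 : ℝ) < 1 by norm_num]
  have p1 := one_sub_pow_pos h0 hq1 r
  have p2 := one_sub_pow_pos h0 hq1 (i + j + r + 1)
  have p3 := one_sub_pow_pos h0 hq1 (i + r)
  have p4 := one_sub_pow_pos h0 hq1 (j + r)
  have p5 : 0 < 1 - q ^ 2 := by nlinarith
  have e : qInt q (r + 1) * qInt q (i + j + r + 2) / (qInt q (i + r + 1) * qInt q (j + r + 1)) =
      (1 - q ^ (2 * (r + 1))) * (1 - q ^ (2 * (i + j + r + 1 + 1))) /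
        ((1 - q ^ (2 * (i + r + 1))) * (1 - q ^ (2 * (j + r + 1)))) / q := by
    simp only [qInt_eq h0.ne']
    rw [show i + j + r + 2 = i + j + r + 1 + 1 from rfl]
    field_simp
    ring
  rw [e]
  refine div_le_div_of_nonneg_right ?_ h0.le
  rw [le_div_iff₀ (mul_pos p3 p4)]
  have l3 : 1 - q ^ (2 * (i + r + 1)) ≤ 1 := by
    linarith [show 0 < q ^ (2 * (i + r + 1)) by positivity]
  have l4 : 1 - q ^ (2 * (j + r + 1)) ≤ 1 := by
    linarith [show 0 < q ^ (2 * (j + r + 1)) by positivity]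
  have l2 : 1 - q ^ (2 * (r + 1)) ≤ 1 - q ^ (2 * (i + j + r + 1 + 1)) :=
    sub_le_sub_left (pow_le_pow_of_le_one h0.le hq1.le (by omega)) 1
  calc _ ≤ (1 - q ^ (2 * (r + 1))) ^ 2 * 1 :=
        mul_le_mul_of_nonneg_left (mul_le_one₀ l3 p4.le l4) (by positivity)
    _ ≤ _ := by rw [mul_one, sq]; exact mul_le_mul_of_nonneg_left l2 p1.le

theorem vertexRatio_pos (hN : 3 ≤ N) (i j r : ℕ) : 0 < vertexRatio N i j r := by
  obtain ⟨h0, h1, -⟩ := qParam_spec hN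
  have hq1 : qParam N < 1 := by linarith [show (0.3821 : ℝ) < 1 by norm_num]
  have p1 := one_sub_pow_pos h0 hq1 r
  exact lt_of_lt_of_le (by positivity) (vertexRatio_lower hN i j r)

theorem vertexNormSq_pos (hN : 3 ≤ N) (i j r : ℕ) : 0 < vertexNormSq N i j r :=
  Finset.prod_pos fun s _ => vertexRatio_pos hN i j s

theorem inv_vertexNormSq_le (hN : 3 ≤ N) (i j r : ℕ) :
    (vertexNormSq N i j r)⁻¹ ≤ constC (qParam N) ^ 2 * qParam N ^ r := by
  obtain ⟨h0, h1, -⟩ := qParam_spec hN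
  have hq1 : qParam N < 1 := by linarith [show (0.3821 : ℝ) < 1 by norm_num]
  have hp : 0 < ∏ s ∈ Finset.range r, (1 - qParam N ^ (2 * (s + 1))) :=
    Finset.prod_pos fun s _ => one_sub_pow_pos h0 hq1 s
  have h2 : (∏ s ∈ Finset.range r, (1 - qParam N ^ (2 * (s + 1)))) ^ 2 / qParam N ^ r ≤
      vertexNormSq N i j r := by
    rw [vertexNormSq, ← Finset.prod_pow]
    conv_lhs => rw [← Finset.card_range r, ← Finset.prod_const, Finset.card_range]
    rw [← Finset.prod_div_distrib]
    refine Finset.prod_le_prod (fun s _ => ?_) fun s _ => vertexRatio_lower hN i j s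
    have p1 := one_sub_pow_pos h0 hq1 s
    positivity
  calc (vertexNormSq N i j r)⁻¹ ≤ _ := inv_anti₀ (by positivity) h2
    _ = ((∏ s ∈ Finset.range r, (1 - qParam N ^ (2 * (s + 1)))) ^ 2)⁻¹ * qParam N ^ r := by
      rw [inv_div, div_eq_inv_mul]
    _ ≤ _ := mul_le_mul_of_nonneg_right ((constC_bounds hN).2 r) (by positivity)

theorem constC_sq_mul_pow_lt_one (hN : 3 ≤ N) {r : ℕ} (hr : 0 < r) :
    constC (qParam N) ^ 2 * qParam N ^ r < 1 := by
  obtain ⟨h0, h1, -⟩ := qParam_spec hN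
  have hq1 : qParam N < 1 := by linarith [show (0.3821 : ℝ) < 1 by norm_num]
  refine lt_of_le_of_lt ?_ (constC_bounds hN).1
  refine mul_le_mul_of_nonneg_left ?_ (sq_nonneg _)
  exact pow_le_of_le_one h0.le hq1.le hr.ne'

/-! ### Tensors as matrices -/

theorem sum_word_comp_rev {M : Type*} [AddCommMonoid M] {n : ℕ} (f : (Fin n → Fin N) → M) :
    ∑ x, f (x ∘ Fin.rev) = ∑ x, f x :=
  let e : (Fin n → Fin N) ≃ (Fin n → Fin N) :=
    ⟨fun x => x ∘ Fin.rev, fun x => x ∘ Fin.rev, comp_rev_rev, comp_rev_rev⟩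
  e.sum_comp f

theorem sum_word_add {M : Type*} [AddCommMonoid M] {i j : ℕ} (f : (Fin (i + j) → Fin N) → M) :
    ∑ z, f z = ∑ x : Fin i → Fin N, ∑ y, f (Fin.append (x ∘ Fin.rev) y) := by
  rw [sum_word_comp_rev fun x => ∑ y, f (Fin.append x y), ← (Fin.appendEquiv i j).sum_comp,
    Fintype.sum_prod_type]
  rfl

/-- A vector of `H_1^{⊗ l} ⊗ H_1^{⊗ m}` as a matrix, with the left words reversed. -/
def tensorMatrix (N l m : ℕ) :
    TPow N l ⊗[ℂ] TPow N m →ₗ[ℂ] Matrix (Fin l → Fin N) (Fin m → Fin N) ℂ :=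
  TensorProduct.lift <| LinearMap.mk₂ ℂ
    (fun η ζ => Matrix.of fun x y => η (x ∘ Fin.rev) * ζ y)
    (fun _ _ _ => by ext; simp [add_mul]) (fun _ _ _ => by ext; simp [mul_assoc])
    (fun _ _ _ => by ext; simp [mul_add]) (fun _ _ _ => by ext; simp [mul_left_comm])

theorem tensorMatrix_tmul {l m : ℕ} (η : TPow N l) (ζ : TPow N m) (x y) :
    tensorMatrix N l m (η ⊗ₜ ζ) x y = η (x ∘ Fin.rev) * ζ y := rfl

theorem inner_eq_trace_tensorMatrix {l m : ℕ} (w w' : TPow N l ⊗[ℂ] TPow N m) :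
    inner ℂ w w' = ((tensorMatrix N l m w)ᴴ * tensorMatrix N l m w').trace := by
  induction w with
  | zero => simp
  | add a b ha hb => rw [inner_add_left, ha, hb, map_add, Matrix.conjTranspose_add,
      Matrix.add_mul, Matrix.trace_add]
  | tmul η ζ =>
    induction w' with
    | zero => simp
    | add a b ha hb => rw [inner_add_right, ha, hb, map_add, Matrix.mul_add, Matrix.trace_add]
    | tmul η' ζ' =>
      rw [TensorProduct.inner_tmul]
      simp only [PiLp.inner_apply, Matrix.trace, Matrix.diag, Matrix.mul_apply,
        Matrix.conjTranspose_apply, tensorMatrix_tmul]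
      rw [← sum_word_comp_rev, mul_comm, Finset.sum_mul_sum]
      refine Finset.sum_congr rfl fun y _ => Finset.sum_congr rfl fun x _ => ?_
      simp only [RCLike.inner_apply, star_mul', RCLike.star_def]
      ring

theorem jwMap_apply {n : ℕ} (v : TPow N n) (x) : jwMap N n v x = ∑ y, jonesWenzl N n x y * v y :=
  rfl

/-- Reversing the left words does no harm because `p_l` commutes with reversal; symmetry of `p_m`
allows it to act from the right. -/
theorem tensorMatrix_map_jwMap (hN : 3 ≤ N) {l m : ℕ} (w : TPow N l ⊗[ℂ] TPow N m) :
    tensorMatrix N l m (TensorProduct.map (jwMap N l) (jwMap N m) w) =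
      jonesWenzl N l * tensorMatrix N l m w * jonesWenzl N m := by
  induction w with
  | zero => simp
  | add a b ha hb => rw [map_add, map_add, ha, hb, map_add, Matrix.mul_add, Matrix.add_mul]
  | tmul η ζ =>
    ext x y
    rw [TensorProduct.map_tmul, tensorMatrix_tmul, jwMap_apply, jwMap_apply,
      ← sum_word_comp_rev, Finset.sum_mul_sum, Finset.sum_comm]
    simp only [Matrix.mul_apply, tensorMatrix_tmul, Finset.sum_mul, jonesWenzl_rev hN]
    refine Finset.sum_congr rfl fun b _ => Finset.sum_congr rfl fun a _ => ?_
    rw [← jonesWenzl_transpose m, Matrix.transpose_apply, jonesWenzl_transpose]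
    ring

theorem occurs_zero_iff {i j : ℕ} (z : Fin (i + j) → Fin N) (x : Fin i → Fin N)
    (y : Fin j → Fin N) : Occurs (i + j) i j 0 z x y ↔ z = Fin.append x y := by
  constructor
  · rintro ⟨h1, h2, -⟩
    funext u
    refine Fin.addCases (fun s => ?_) (fun s => ?_) u
    · rw [Fin.append_left, h1 s (s.castAdd j) (by simp) (by simp)]
    · rw [Fin.append_right, h2 s (s.natAdd i) (by simp) (by simp)]
  · rintro rfl
    refine ⟨fun s t _ h => ?_, fun s t _ h => ?_, fun s t h => by omega⟩
    · obtain rfl : t = s.castAdd j := Fin.ext h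
      rw [Fin.append_left]
    · obtain rfl : t = s.natAdd i := Fin.ext (by simpa using h)
      rw [Fin.append_right]

/-- The letters `a` and `b` are adjacent to the cut, so prefixing them adds an innermost cup. -/
theorem occurs_succ_iff {i j r : ℕ} (z : Fin (i + j) → Fin N) (a b : Fin N)
    (x : Fin (i + r) → Fin N) (y : Fin (j + r) → Fin N) :
    Occurs (i + j) (i + r + 1) (j + r + 1) (r + 1) z
      ((Fin.cons a x : Fin (i + r + 1) → Fin N) ∘ Fin.rev) (Fin.cons b y) ↔
    a = b ∧ Occurs (i + j) (i + r) (j + r) r z (x ∘ Fin.rev) y := by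
  have hx : ∀ s : Fin (i + r), ((Fin.cons a x : Fin (i + r + 1) → Fin N) ∘ Fin.rev) s.castSucc =
      (x ∘ Fin.rev) s := fun s => by
    rw [Function.comp_apply, Fin.rev_castSucc, Fin.cons_succ, Function.comp_apply]
  have hx' : ((Fin.cons a x : Fin (i + r + 1) → Fin N) ∘ Fin.rev) (Fin.last _) = a := by
    rw [Function.comp_apply, Fin.rev_last, Fin.cons_zero]
  constructor
  · rintro ⟨h1, h2, h3⟩
    refine ⟨?_, fun s t h h' => ?_, fun s t h h' => ?_, fun s t h h' => ?_⟩
    · have := h3 (Fin.last _) 0 (by simp) (by simp)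
      rwa [hx', Fin.cons_zero] at this
    · rw [← hx]; exact h1 _ _ (by simp; omega) (by simpa using h')
    · have := h2 s.succ t (by simp; omega) (by simp; omega)
      rwa [Fin.cons_succ] at this
    · have := h3 s.castSucc t.succ (by simp; omega) (by simp; omega)
      rwa [hx, Fin.cons_succ] at this
  · rintro ⟨rfl, h1, h2, h3⟩
    refine ⟨fun s t h h' => ?_, fun s t h h' => ?_, fun s t h h' => ?_⟩
    · obtain ⟨s, rfl⟩ : ∃ s', s = Fin.castSucc s' := ⟨⟨s, by omega⟩, rfl⟩
      rw [hx]; exact h1 _ _ (by simp at h; omega) (by simpa using h')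
    · obtain ⟨s, rfl⟩ : ∃ s', s = Fin.succ s' :=
        Fin.eq_succ_of_ne_zero fun h0 => by rw [h0] at h; simp at h
      rw [Fin.cons_succ]
      simp only [Fin.val_succ] at h h'
      exact h2 _ _ (by omega) (by omega)
    · rcases Fin.eq_zero_or_eq_succ t with rfl | ⟨t, rfl⟩
      · obtain rfl : s = Fin.last _ := Fin.ext (by simpa using h')
        rw [hx', Fin.cons_zero]
      · simp only [Fin.val_succ] at h h'
        obtain ⟨s, rfl⟩ : ∃ s', s = Fin.castSucc s' := ⟨⟨s, by omega⟩, rfl⟩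
        rw [hx, Fin.cons_succ]
        exact h3 _ _ (by omega) (by simp at h'; omega)

open Classical in
theorem insertMatrix_splitRev_apply {i j : ℕ} (v : (Fin (i + j) → Fin N) → ℂ) (r : ℕ) :
    ∀ (x : Fin (i + r) → Fin N) (y : Fin (j + r) → Fin N),
    insertMatrix (splitRev v) r x y =
      ∑ z, v z * if Occurs (i + j) (i + r) (j + r) r z (x ∘ Fin.rev) y then 1 else 0 := by
  induction r with
  | zero =>
    intro x y
    have h : ∀ z, Occurs (i + j) (i + 0) (j + 0) 0 z (x ∘ Fin.rev) y ↔
        z = Fin.append ((x : Fin i → Fin N) ∘ Fin.rev) (y : Fin j → Fin N) :=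
      fun z => occurs_zero_iff z _ _
    simp only [h, mul_ite, mul_one, mul_zero, Finset.sum_ite_eq', Finset.mem_univ, if_true]
    rfl
  | succ r ih =>
    refine word_cases fun a x => word_cases fun b y => ?_
    refine (consId_cons _ a b x y).trans ?_
    have h : ∀ z, Occurs (i + j) (i + (r + 1)) (j + (r + 1)) (r + 1) z
        ((Fin.cons a x : Fin (i + r + 1) → Fin N) ∘ Fin.rev)
        (Fin.cons b y : Fin (j + r + 1) → Fin N) ↔
        a = b ∧ Occurs (i + j) (i + r) (j + r) r z (x ∘ Fin.rev) y :=
      fun z => occurs_succ_iff z a b x y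
    simp only [h, ih]
    by_cases hab : a = b <;> simp [hab]

theorem tensorMatrix_basisVec {l m : ℕ} (x' x : Fin l → Fin N) (y' y : Fin m → Fin N) :
    tensorMatrix N l m (basisVec N l x' ⊗ₜ basisVec N m y') x y =
      if x' = x ∘ Fin.rev ∧ y' = y then 1 else 0 := by
  rw [tensorMatrix_tmul]
  simp only [basisVec, PiLp.single_apply, mul_ite, mul_one, mul_zero, ite_and,
    eq_comm (a := x'), eq_comm (a := y')]
  split_ifs <;> rfl

open Classical in
theorem insertCups_apply {k l m r : ℕ} (v : TPow N k) : insertCups N k l m r v =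
    ∑ z, v z • ∑ x : Fin l → Fin N, ∑ y : Fin m → Fin N,
      if Occurs k l m r z x y then basisVec N l x ⊗ₜ[ℂ] basisVec N m y else 0 := by
  rw [insertCups, Module.Basis.constr_apply_fintype]
  rfl

theorem tensorMatrix_insertCups {i j r : ℕ} (v : TPow N (i + j)) :
    tensorMatrix N (i + r) (j + r) (insertCups N (i + j) (i + r) (j + r) r v) =
      insertMatrix (splitRev v) r := by
  classical
  ext x y
  rw [insertCups_apply, insertMatrix_splitRev_apply, map_sum, Matrix.sum_apply]
  refine Finset.sum_congr rfl fun z _ => ?_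
  simp only [map_smul, Matrix.smul_apply, map_sum, Matrix.sum_apply, smul_eq_mul,
    apply_ite (tensorMatrix N (i + r) (j + r)), map_zero]
  congr 1
  rw [Finset.sum_eq_single (x ∘ Fin.rev), Finset.sum_eq_single y]
  · split_ifs
    · rw [tensorMatrix_basisVec, if_pos ⟨rfl, rfl⟩]
    · rfl
  · intro y' _ hy
    split_ifs
    · rw [tensorMatrix_basisVec, if_neg fun h => hy h.2]
    · rfl
  · simp
  · intro x' _ hx
    refine Finset.sum_eq_zero fun y' _ => ?_
    split_ifs
    · rw [tensorMatrix_basisVec, if_neg fun h => hx h.1]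
    · rfl
  · simp

theorem trace_splitRev {i j : ℕ} (v w : TPow N (i + j)) :
    ((splitRev v : Matrix (Fin i → Fin N) (Fin j → Fin N) ℂ)ᴴ * splitRev w).trace =
      inner ℂ v w := by
  simp only [PiLp.inner_apply, sum_word_add, Matrix.trace, Matrix.diag, Matrix.mul_apply,
    Matrix.conjTranspose_apply]
  rw [Finset.sum_comm]
  refine Finset.sum_congr rfl fun x _ => Finset.sum_congr rfl fun y _ => ?_
  simp only [RCLike.inner_apply, RCLike.star_def, splitRev, Matrix.of_apply]
  ring

/-! ### The bilinear form of nested cups on product vectors -/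

theorem norm_sum_mul_le_hilbertSchmidt {ι κ : Type*} [Fintype ι] [Fintype κ] (X : Matrix ι κ ℂ)
    (η : ι → ℂ) (ζ : κ → ℂ) :
    ‖∑ x, ∑ y, η x * ζ y * X x y‖ ≤
      √(∑ x, ∑ y, ‖X x y‖ ^ 2) * (√(∑ x, ‖η x‖ ^ 2) * √(∑ y, ‖ζ y‖ ^ 2)) := by
  have h := Real.sum_mul_le_sqrt_mul_sqrt (Finset.univ : Finset (ι × κ))
    (fun p => ‖X p.1 p.2‖) fun p => ‖η p.1‖ * ‖ζ p.2‖
  rw [← Real.sqrt_mul (Finset.sum_nonneg fun _ _ => sq_nonneg _), Finset.sum_mul_sum]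
  simp only [Fintype.sum_prod_type, mul_pow] at h
  refine le_trans ?_ h
  refine (norm_sum_le _ _).trans (Finset.sum_le_sum fun x _ => ?_)
  refine (norm_sum_le _ _).trans (Finset.sum_le_sum fun y _ => ?_)
  rw [norm_mul, norm_mul, mul_comm]

/-- A cup sums, over its letter `s`, the forms of the slices of `η` and `ζ` at `s`. Cauchy–Schwarz
in `s` reassembles the norms, so no power of `N` is lost. -/
theorem norm_sum_mul_insertMatrix_le {a b : ℕ} (X : Matrix (Fin a → Fin N) (Fin b → Fin N) ℂ)
    (r : ℕ) : ∀ (η : (Fin (a + r) → Fin N) → ℂ) (ζ : (Fin (b + r) → Fin N) → ℂ),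
    ‖∑ x, ∑ y, η x * ζ y * insertMatrix X r x y‖ ≤
      √(∑ x, ∑ y, ‖X x y‖ ^ 2) * (√(∑ x, ‖η x‖ ^ 2) * √(∑ y, ‖ζ y‖ ^ 2)) := by
  induction r with
  | zero => exact norm_sum_mul_le_hilbertSchmidt X
  | succ r ih =>
    intro η ζ
    change (Fin (a + r + 1) → Fin N) → ℂ at η
    change (Fin (b + r + 1) → Fin N) → ℂ at ζ
    have e : ∑ x, ∑ y, η x * ζ y * consId (insertMatrix X r) x y =
        ∑ s : Fin N, ∑ x, ∑ y, η (Fin.cons s x : Fin (a + r + 1) → Fin N) *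
          ζ (Fin.cons s y : Fin (b + r + 1) → Fin N) * insertMatrix X r x y := by
      simp only [sum_word_succ, consId_cons]
      refine Finset.sum_congr rfl fun s _ => Finset.sum_congr rfl fun x _ => ?_
      rw [Finset.sum_eq_single s (by intro u _ hu; simp [hu.symm]) (by simp)]
      simp
    change ‖∑ x, ∑ y, η x * ζ y * consId (insertMatrix X r) x y‖ ≤
      _ * (√(∑ x, ‖η x‖ ^ 2) * √(∑ y, ‖ζ y‖ ^ 2))
    rw [e, sum_word_succ (fun x => ‖η x‖ ^ 2), sum_word_succ (fun x => ‖ζ x‖ ^ 2)]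
    refine (norm_sum_le _ _).trans ((Finset.sum_le_sum fun s _ => ih _ _).trans ?_)
    rw [← Finset.mul_sum]
    refine mul_le_mul_of_nonneg_left ?_ (Real.sqrt_nonneg _)
    refine (Real.sum_mul_le_sqrt_mul_sqrt _ _ _).trans (le_of_eq ?_)
    congr 2 <;>
    exact Finset.sum_congr rfl fun s _ => Real.sq_sqrt (Finset.sum_nonneg fun _ _ => sq_nonneg _)

theorem norm_inner_tmul_insertCups_le {i j r : ℕ} (η : TPow N (i + r)) (ζ : TPow N (j + r))
    (v : TPow N (i + j)) :
    ‖inner ℂ (η ⊗ₜ[ℂ] ζ) (insertCups N (i + j) (i + r) (j + r) r v)‖ ≤ ‖η‖ * ‖ζ‖ * ‖v‖ := by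
  rw [inner_eq_trace_tensorMatrix, tensorMatrix_insertCups]
  have h := norm_sum_mul_insertMatrix_le (splitRev v : Matrix (Fin i → Fin N) (Fin j → Fin N) ℂ) r
    (fun x => star (η (x ∘ Fin.rev))) (fun y => star (ζ y))
  have e : ((tensorMatrix N (i + r) (j + r) (η ⊗ₜ ζ))ᴴ * insertMatrix (splitRev v) r).trace =
      ∑ x, ∑ y, star (η (x ∘ Fin.rev)) * star (ζ y) * insertMatrix (splitRev v) r x y := by
    simp only [Matrix.trace, Matrix.diag, Matrix.mul_apply, Matrix.conjTranspose_apply,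
      tensorMatrix_tmul, star_mul']
    exact Finset.sum_comm
  rw [e]
  refine h.trans (le_of_eq ?_)
  simp only [norm_star]
  rw [sum_word_comp_rev fun x => ‖η x‖ ^ 2, EuclideanSpace.norm_eq, EuclideanSpace.norm_eq,
    EuclideanSpace.norm_eq, sum_word_add fun z => ‖v z‖ ^ 2, mul_comm]
  rfl

/-! ### The spaces `H_n` and the three-vertices -/

/-- The inclusion `H_n → H_1^{⊗ n}` as an isometry. -/
def hwIsometry (N n : ℕ) : HW N n →ₗᵢ[ℂ] TPow N n := (hwSubspace N n).subtypeₗᵢ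

theorem hwIncl_hwProj {n : ℕ} (v : TPow N n) : hwIncl N n (hwProj N n v) = jwMap N n v := rfl

theorem jwMap_eq_of_turnbackFree {n : ℕ} {v : TPow N n} (hv : TurnbackFree v) :
    jwMap N n v = v := by
  ext x
  exact congrFun hv.jonesWenzl_mulVec x

theorem turnbackFree_hwIncl (hN : 3 ≤ N) {n : ℕ} (ξ : HW N n) : TurnbackFree (hwIncl N n ξ) := by
  obtain ⟨v, hv⟩ : ∃ v, jwMap N n v = hwIncl N n ξ := ξ.2
  rw [← hv]
  exact turnbackFree_jonesWenzl_mulVec hN v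

theorem jwMap_hwIncl (hN : 3 ≤ N) {n : ℕ} (ξ : HW N n) :
    jwMap N n (hwIncl N n ξ) = hwIncl N n ξ :=
  jwMap_eq_of_turnbackFree (turnbackFree_hwIncl hN ξ)

theorem inner_map_hwIncl {l m : ℕ} (x y : HW N l ⊗[ℂ] HW N m) :
    inner ℂ (TensorProduct.map (hwIncl N l) (hwIncl N m) x)
      (TensorProduct.map (hwIncl N l) (hwIncl N m) y) = inner ℂ x y :=
  TensorProduct.inner_map_map (hwIsometry N l) (hwIsometry N m) x y

theorem map_hwIncl_map_hwProj {l m : ℕ} (w : TPow N l ⊗[ℂ] TPow N m) :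
    TensorProduct.map (hwIncl N l) (hwIncl N m)
      (TensorProduct.map (hwProj N l) (hwProj N m) w) =
      TensorProduct.map (jwMap N l) (jwMap N m) w := by
  rw [← LinearMap.comp_apply, ← TensorProduct.map_comp]
  rfl

theorem inner_tensor_smul_right {E F : Type*} [NormedAddCommGroup E] [InnerProductSpace ℂ E]
    [NormedAddCommGroup F] [InnerProductSpace ℂ F] (z : ℂ) (w w' : E ⊗[ℂ] F) :
    inner ℂ w (z • w') = z * inner ℂ w w' :=
  inner_smul_right (𝕜 := ℂ) (E := E ⊗[ℂ] F) w w' z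

theorem threeVertex_apply {i j r : ℕ} (ξ : HW N (i + j)) :
    threeVertex N (i + j) (i + r) (j + r) ξ =
      TensorProduct.map (hwProj N (i + r)) (hwProj N (j + r))
        (insertCups N (i + j) (i + r) (j + r) r (hwIncl N (i + j) ξ)) := by
  rw [threeVertex, show (i + r + (j + r) - (i + j)) / 2 = r by omega]
  rfl

theorem inner_threeVertex (hN : 3 ≤ N) {i j r : ℕ} (ξ ξ' : HW N (i + j)) :
    inner ℂ (threeVertex N (i + j) (i + r) (j + r) ξ) (threeVertex N (i + j) (i + r) (j + r) ξ') =
      vertexNormSq N i j r * inner ℂ ξ ξ' := by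
  rw [← inner_map_hwIncl, threeVertex_apply, threeVertex_apply, map_hwIncl_map_hwProj,
    map_hwIncl_map_hwProj, inner_eq_trace_tensorMatrix, tensorMatrix_map_jwMap hN,
    tensorMatrix_map_jwMap hN, tensorMatrix_insertCups, tensorMatrix_insertCups]
  refine ((turnbackFree_hwIncl hN ξ).trace_vertexMatrix_eq hN (turnbackFree_hwIncl hN ξ') r).trans ?_
  rw [trace_splitRev]
  rfl

theorem norm_threeVertex (hN : 3 ≤ N) {i j r : ℕ} (ξ : HW N (i + j)) :
    ‖threeVertex N (i + j) (i + r) (j + r) ξ‖ = √(vertexNormSq N i j r) * ‖ξ‖ := by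
  have h := inner_threeVertex hN (r := r) ξ ξ
  have h0 : inner ℂ (threeVertex N (i + j) (i + r) (j + r) ξ)
      (threeVertex N (i + j) (i + r) (j + r) ξ) =
      (‖threeVertex N (i + j) (i + r) (j + r) ξ‖ : ℂ) ^ 2 :=
    inner_self_eq_norm_sq_to_K (𝕜 := ℂ) (E := HW N (i + r) ⊗[ℂ] HW N (j + r)) _
  rw [h0, inner_self_eq_norm_sq_to_K] at h
  have h' : ‖threeVertex N (i + j) (i + r) (j + r) ξ‖ ^ 2 = vertexNormSq N i j r * ‖ξ‖ ^ 2 := by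
    apply Complex.ofReal_injective
    push_cast
    exact h
  rw [← Real.sqrt_sq (norm_nonneg (threeVertex N (i + j) (i + r) (j + r) ξ)), h',
    Real.sqrt_mul (vertexNormSq_pos hN i j r).le, Real.sqrt_sq (norm_nonneg _)]

/-! ### Alternating tensors in `H_n`. -/

theorem turnbackFree_altVec {n : ℕ} {i j : Fin N} (hij : i ≠ j) : TurnbackFree (altVec N n i j) := by
  intro s t hst y hs ht _
  refine Finset.sum_eq_zero fun b _ => ?_
  rw [altVec, basisVec, PiLp.single_apply, if_neg]
  intro h
  have h1 := congrFun h s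
  have h2 := congrFun h t
  rw [hs] at h1
  rw [ht, h1] at h2
  rcases hst with hst | hst <;> rw [hst] at h2 <;> simp only [Nat.even_add_one] at h2 <;>
  split_ifs at h2 <;> first | exact hij h2 | exact hij h2.symm

theorem hwIncl_hwProj_altVec {n : ℕ} {i j : Fin N} (hij : i ≠ j) :
    hwIncl N n (hwProj N n (altVec N n i j)) = altVec N n i j := by
  rw [hwIncl_hwProj, jwMap_eq_of_turnbackFree (turnbackFree_altVec hij)]

theorem norm_altVec {n : ℕ} (i j : Fin N) : ‖altVec N n i j‖ = 1 := by
  simp [altVec, basisVec]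

theorem norm_hwProj_altVec {n : ℕ} {i j : Fin N} (hij : i ≠ j) :
    ‖hwProj N n (altVec N n i j)‖ = 1 := by
  rw [← norm_altVec (n := n) i j, ← hwIncl_hwProj_altVec hij]
  exact (congrArg (fun v => ‖hwProj N n v‖) (hwIncl_hwProj_altVec hij)).trans rfl

theorem exists_ne_fin (hN : 3 ≤ N) : ∃ i j : Fin N, i ≠ j :=
  ⟨⟨0, by omega⟩, ⟨1, by omega⟩, by simp⟩

theorem nontrivial_HW (hN : 3 ≤ N) (n : ℕ) : Nontrivial (HW N n) := by
  obtain ⟨i, j, hij⟩ := exists_ne_fin hN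
  refine ⟨hwProj N n (altVec N n i j), 0, fun h => ?_⟩
  have := norm_hwProj_altVec (n := n) hij
  rw [h, norm_zero] at this
  exact zero_ne_one this

/-! ### Normalisation of the three-vertices and overlaps with product vectors. -/

theorem opNorm_threeVertex (hN : 3 ≤ N) (i j r : ℕ) :
    ‖LinearMap.toContinuousLinearMap (threeVertex N (i + j) (i + r) (j + r))‖ =
      √(vertexNormSq N i j r) :=
  have := nontrivial_HW hN (i + j)
  ContinuousLinearMap.homothety_norm _ fun ξ => norm_threeVertex hN ξ

theorem alpha_apply (hN : 3 ≤ N) {i j r : ℕ} (ξ : HW N (i + j)) :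
    alpha N (i + j) (i + r) (j + r) ξ =
      (((√(vertexNormSq N i j r))⁻¹ : ℝ) : ℂ) • threeVertex N (i + j) (i + r) (j + r) ξ := by
  rw [alpha, opNorm_threeVertex hN]
  rfl

theorem norm_alpha (hN : 3 ≤ N) {i j r : ℕ} (ξ : HW N (i + j)) :
    ‖alpha N (i + j) (i + r) (j + r) ξ‖ = ‖ξ‖ := by
  have h := Real.sqrt_pos.2 (vertexNormSq_pos hN i j r)
  rw [alpha_apply hN, norm_smul, norm_threeVertex hN, Complex.norm_real, norm_inv,
    Real.norm_of_nonneg h.le, inv_mul_cancel_left₀ h.ne']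

theorem threeVertex_mem_range_alpha (hN : 3 ≤ N) {i j r : ℕ} (ξ : HW N (i + j)) :
    threeVertex N (i + j) (i + r) (j + r) ξ ∈
      LinearMap.range (alpha N (i + j) (i + r) (j + r)) := by
  have h := Real.sqrt_pos.2 (vertexNormSq_pos hN i j r)
  refine ⟨((√(vertexNormSq N i j r) : ℝ) : ℂ) • ξ, ?_⟩
  rw [map_smul, alpha_apply hN, smul_smul, ← Complex.ofReal_mul, mul_inv_cancel₀ h.ne',
    Complex.ofReal_one, one_smul]

/-- The self-adjoint projections move to `e ⊗ f`, which they fix. -/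
theorem inner_tmul_threeVertex (hN : 3 ≤ N) {i j r : ℕ} (e : HW N (i + r)) (f : HW N (j + r))
    (ξ : HW N (i + j)) :
    inner ℂ (e ⊗ₜ[ℂ] f) (threeVertex N (i + j) (i + r) (j + r) ξ) =
      inner ℂ (hwIncl N (i + r) e ⊗ₜ[ℂ] hwIncl N (j + r) f)
        (insertCups N (i + j) (i + r) (j + r) r (hwIncl N (i + j) ξ)) := by
  have h := tensorMatrix_map_jwMap hN (hwIncl N (i + r) e ⊗ₜ[ℂ] hwIncl N (j + r) f)
  rw [TensorProduct.map_tmul, jwMap_hwIncl hN, jwMap_hwIncl hN] at h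
  rw [← inner_map_hwIncl, threeVertex_apply, map_hwIncl_map_hwProj, TensorProduct.map_tmul,
    inner_eq_trace_tensorMatrix, inner_eq_trace_tensorMatrix, tensorMatrix_map_jwMap hN]
  have h' := congrArg Matrix.conjTranspose h
  simp only [Matrix.conjTranspose_mul, jonesWenzl_conjTranspose] at h'
  rw [← Matrix.mul_assoc, Matrix.trace_mul_comm, ← Matrix.mul_assoc, ← Matrix.mul_assoc,
    Matrix.mul_assoc (jonesWenzl N (j + r)), ← h']

theorem norm_inner_tmul_alpha_sq_le (hN : 3 ≤ N) {i j r : ℕ} (e : HW N (i + r)) (f : HW N (j + r))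
    (ξ : HW N (i + j)) (he : ‖e‖ = 1) (hf : ‖f‖ = 1) (hξ : ‖ξ‖ = 1) :
    ‖inner ℂ (e ⊗ₜ[ℂ] f) (alpha N (i + j) (i + r) (j + r) ξ)‖ ^ 2 ≤
      constC (qParam N) ^ 2 * qParam N ^ r := by
  have h := Real.sqrt_pos.2 (vertexNormSq_pos hN i j r)
  have h1 : ‖inner ℂ (e ⊗ₜ[ℂ] f) (threeVertex N (i + j) (i + r) (j + r) ξ)‖ ≤ 1 := by
    rw [inner_tmul_threeVertex hN]
    refine (norm_inner_tmul_insertCups_le _ _ _).trans (le_of_eq ?_)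
    change ‖e‖ * ‖f‖ * ‖ξ‖ = 1
    rw [he, hf, hξ, mul_one, mul_one]
  refine le_trans ?_ (inv_vertexNormSq_le hN i j r)
  rw [alpha_apply hN, inner_tensor_smul_right, norm_mul, Complex.norm_real, mul_pow, norm_inv,
    Real.norm_of_nonneg h.le, inv_pow, Real.sq_sqrt (vertexNormSq_pos hN i j r).le]
  exact mul_le_of_le_one_right (inv_nonneg.2 (vertexNormSq_pos hN i j r).le)
    (pow_le_one₀ (norm_nonneg _) h1)

/-! ### Schmidt coefficients as overlaps with product vectors. -/

theorem IsSchmidtDecomposition.inner_tmul_eq {E F : Type*} [NormedAddCommGroup E]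
    [InnerProductSpace ℂ E] [NormedAddCommGroup F] [InnerProductSpace ℂ F] {n : ℕ}
    {ξ : E ⊗[ℂ] F} {lam : Fin n → ℝ} {e : Fin n → E} {f : Fin n → F}
    (h : IsSchmidtDecomposition ξ lam e f) (i : Fin n) :
    inner ℂ (e i ⊗ₜ[ℂ] f i) ξ = ((√(lam i) : ℝ) : ℂ) := by
  rw [h.eq_sum, inner_sum, Finset.sum_eq_single i]
  · rw [inner_tensor_smul_right, TensorProduct.inner_tmul, inner_self_eq_norm_sq_to_K,
      inner_self_eq_norm_sq_to_K, h.orthonormal_left.1, h.orthonormal_right.1]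
    simp
  · intro b _ hb
    rw [inner_tensor_smul_right, TensorProduct.inner_tmul, h.orthonormal_left.2 hb.symm]
    simp
  · simp

theorem schmidtCoeffsLE_alpha (hN : 3 ≤ N) (i j r : ℕ) :
    SchmidtCoeffsLE (LinearMap.range (alpha N (i + j) (i + r) (j + r)))
      (constC (qParam N) ^ 2 * qParam N ^ r) := by
  rintro _ ⟨ξ, rfl⟩ hξ n lam e f hS s
  rw [norm_alpha hN] at hξ
  have h := norm_inner_tmul_alpha_sq_le hN (e s) (f s) ξ (hS.orthonormal_left.1 s)
    (hS.orthonormal_right.1 s) hξ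
  rwa [hS.inner_tmul_eq, Complex.norm_real, Real.norm_of_nonneg (Real.sqrt_nonneg _),
    Real.sq_sqrt (hS.nonneg s)] at h

/-- A bound below one for the Schmidt coefficients excludes product vectors. -/
theorem SchmidtCoeffsLE.isEntangledSubspace {E F : Type*} [NormedAddCommGroup E]
    [InnerProductSpace ℂ E] [NormedAddCommGroup F] [InnerProductSpace ℂ F]
    {K : Submodule ℂ (E ⊗[ℂ] F)} {c : ℝ} (h : SchmidtCoeffsLE K c) (hc : c < 1) :
    IsEntangledSubspace K := by
  rintro ξ hξ ⟨h0, η, ζ, rfl⟩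
  have hη : ‖η‖ ≠ 0 := fun h => h0 (by rw [norm_eq_zero.1 h, TensorProduct.zero_tmul])
  have hζ : ‖ζ‖ ≠ 0 := fun h => h0 (by rw [norm_eq_zero.1 h, TensorProduct.tmul_zero])
  set η' : E := ((‖η‖⁻¹ : ℝ) : ℂ) • η
  set ζ' : F := ((‖ζ‖⁻¹ : ℝ) : ℂ) • ζ
  have h1 : ‖η'‖ = 1 := by simp [η', norm_smul, hη]
  have h2 : ‖ζ'‖ = 1 := by simp [ζ', norm_smul, hζ]
  have hmem : η' ⊗ₜ[ℂ] ζ' ∈ K := by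
    rw [TensorProduct.smul_tmul_smul]
    exact K.smul_mem _ hξ
  -- A unit product vector is its own one-term Schmidt decomposition, with coefficient one.
  have hle := h _ hmem (by rw [TensorProduct.norm_tmul, h1, h2, mul_one]) 1 (fun _ => 1)
    (fun _ => η') (fun _ => ζ')
    { nonneg := fun _ => zero_le_one
      orthonormal_left := ⟨fun _ => h1, fun a b hab => (hab (Subsingleton.elim a b)).elim⟩
      orthonormal_right := ⟨fun _ => h2, fun a b hab => (hab (Subsingleton.elim a b)).elim⟩
      eq_sum := by simp } 0
  exact hc.not_ge hle

/-! ### Product vectors at the highest weight. -/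

theorem insertCups_basisVec_append {l m : ℕ} (x : Fin l → Fin N) (y : Fin m → Fin N) :
    insertCups N (l + m) l m 0 (basisVec N (l + m) (Fin.append x y)) =
      basisVec N l x ⊗ₜ[ℂ] basisVec N m y := by
  classical
  rw [insertCups_apply, Finset.sum_eq_single (Fin.append x y), Finset.sum_eq_single x,
    Finset.sum_eq_single y]
  · rw [if_pos ((occurs_zero_iff _ _ _).2 rfl)]
    simp [basisVec]
  · intro y' _ hy
    rw [if_neg]
    intro h
    have h' := (occurs_zero_iff _ _ _).1 h
    exact hy (funext fun s => by simpa using (congrFun h' (s.natAdd l)).symm)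
  · simp
  · intro x' _ hx
    refine Finset.sum_eq_zero fun y' _ => ?_
    rw [if_neg]
    intro h
    have h' := (occurs_zero_iff _ _ _).1 h
    exact hx (funext fun s => by simpa using (congrFun h' (s.castAdd m)).symm)
  · simp
  · intro z _ hz
    rw [basisVec, PiLp.single_apply, if_neg hz, zero_smul]
  · simp

/-- Position `s` of the right part is position `l + s` of the whole word, so an odd `l` swaps the
two letters. -/
theorem altVec_add (l m : ℕ) (i j : Fin N) : ∃ x y, altVec N (l + m) i j =
    basisVec N (l + m) (Fin.append x y) ∧ basisVec N l x = altVec N l i j ∧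
      basisVec N m y = if Even l then altVec N m i j else altVec N m j i := by
  refine ⟨fun s => if Even s.val then i else j,
    fun s => if Even (l + s.val) then i else j, ?_, rfl, ?_⟩
  · rw [altVec]
    congr 1
    funext u
    refine Fin.addCases (fun s => ?_) (fun s => ?_) u <;> simp
  · split_ifs with hl
    · simp only [altVec, Nat.even_add, hl, true_iff]
    · simp only [altVec, Nat.even_add, hl, false_iff, ite_not]

theorem altVec_tmul_mem_range_alpha (hN : 3 ≤ N) (l m : ℕ) {i j : Fin N} (hij : i ≠ j) :
    hwProj N l (altVec N l i j) ⊗ₜ[ℂ]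
      hwProj N m (if Even l then altVec N m i j else altVec N m j i) ∈
      LinearMap.range (alpha N (l + m) l m) := by
  have h := threeVertex_mem_range_alpha hN (r := 0) (hwProj N (l + m) (altVec N (l + m) i j))
  obtain ⟨x, y, h1, h2, h3⟩ := altVec_add l m i j
  rw [threeVertex_apply, hwIncl_hwProj_altVec hij] at h
  change TensorProduct.map (hwProj N l) (hwProj N m)
    (insertCups N (l + m) l m 0 (altVec N (l + m) i j)) ∈
      LinearMap.range (alpha N (l + m) l m) at h
  rwa [h1, insertCups_basisVec_append, TensorProduct.map_tmul, h2, h3] at h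

theorem isJonesWenzl_jonesWenzl (hN : 3 ≤ N) (n : ℕ) : IsJonesWenzl N n (jonesWenzl N n) where
  intertwiner := isIntertwiner_jonesWenzl n
  ne_zero h := by
    obtain ⟨i, j, hij⟩ := exists_ne_fin hN
    have h1 := jwMap_eq_of_turnbackFree (turnbackFree_altVec (n := n) hij)
    rw [jwMap, h, map_zero, LinearMap.zero_apply] at h1
    have h2 := norm_altVec (n := n) i j
    rw [← h1, norm_zero] at h2
    exact zero_ne_one h2
  selfAdjoint := jonesWenzl_conjTranspose n
  idempotent := jonesWenzl_idempotent hN n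
  cupCap_mul := cupCap_mul_jonesWenzl hN n

end FreeOrth
end

open FreeOrth in
theorem theorem3p3 (N : ℕ) (hN : 3 ≤ N) (k l m : ℕ) (hadm : Admissible k l m) :
    -- the operators `p_n` are the Jones-Wenzl projections of `O_N⁺`, and `α_k^{l,m}` is an isometry
    (∀ n : ℕ, IsJonesWenzl N n (jonesWenzl N n)) ∧
    (∀ ξ : HW N k, ‖alpha N k l m ξ‖ = ‖ξ‖) ∧
    -- below the highest weight
    (k < l + m →
      IsEntangledSubspace (LinearMap.range (alpha N k l m)) ∧
      IsHighlyEntangled (LinearMap.range (alpha N k l m)) ∧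
      SchmidtCoeffsLE (LinearMap.range (alpha N k l m))
        (constC (qParam N) ^ 2 * qParam N ^ (((l : ℝ) + m - k) / 2)) ∧
      constC (qParam N) ^ 2 * qParam N ^ (((l : ℝ) + m - k) / 2) < 1) ∧
    -- at the highest weight
    (k = l + m →
      IsSeparableSubspace (LinearMap.range (alpha N k l m)) ∧
      ∀ i j : Fin N, i ≠ j →
        ∃ (η : HW N l) (ζ : HW N m), hwIncl N l η = altVec N l i j ∧
          hwIncl N m ζ = (if Even l then altVec N m i j else altVec N m j i) ∧
          η ⊗ₜ[ℂ] ζ ∈ LinearMap.range (alpha N k l m)) := by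
  refine ⟨isJonesWenzl_jonesWenzl hN, ?_⟩
  obtain ⟨r, hr, hk⟩ := hadm
  -- With `l = a + r`, `m = b + r` and `k = a + b`, all subtractions disappear and `r` is the number
  -- of cups.
  obtain ⟨a, rfl⟩ : ∃ a, l = a + r := ⟨l - r, by omega⟩
  obtain ⟨b, rfl⟩ : ∃ b, m = b + r := ⟨m - r, by omega⟩
  obtain rfl : k = a + b := by omega
  refine ⟨norm_alpha hN, fun hlt => ?_, fun heq => ?_⟩
  · have hexp : (((a + r : ℕ) : ℝ) + (b + r : ℕ) - (a + b : ℕ)) / 2 = (r : ℝ) := by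
      push_cast; ring
    have h1 := schmidtCoeffsLE_alpha hN a b r
    have h2 := constC_sq_mul_pow_lt_one hN (r := r) (by omega)
    rw [hexp, Real.rpow_natCast]
    exact ⟨h1.isEntangledSubspace h2, ⟨_, h2, h1⟩, h1, h2⟩
  · obtain rfl : r = 0 := by omega
    refine ⟨?_, fun i j hij => ?_⟩
    · obtain ⟨i, j, hij⟩ := exists_ne_fin hN
      refine ⟨_, altVec_tmul_mem_range_alpha hN a b hij, ?_, _, _, rfl⟩
      rw [← norm_ne_zero_iff, TensorProduct.norm_tmul, norm_hwProj_altVec hij]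
      split_ifs
      · rw [norm_hwProj_altVec hij]; norm_num
      · rw [norm_hwProj_altVec hij.symm]; norm_num
    · refine ⟨_, _, hwIncl_hwProj_altVec hij, ?_, altVec_tmul_mem_range_alpha hN a b hij⟩
      change hwIncl N b _ = if Even a then altVec N b i j else altVec N b j i
      split_ifs
      · exact hwIncl_hwProj_altVec hij
      · exact hwIncl_hwProj_altVec hij.symm
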